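/- Let $n\ge 2$, $1<p<n$, $\nu>0$, $\mu\ge 1$, $\sigma\in(1,\infty)$, and let $\Omega\subset\mathbb R^n$ be a bounded open set. Let $g:[0,\infty)\to[0,\infty)$ be $C^1$, convex and non-decreasing, with $g(0)=0$, $g(t)>0$ for $t>0$, $g'(0_+)>0$, and $g(\lambda t)\le\lambda^\mu g(t)$ for all $\lambda>1$, $t>0$. Let $f:\Omega\times\mathbb R^n\to\mathbb R$ be a Carathéodory function and $a:\Omega\to[0,\infty)$ a function with $$\nu\, g^p(|z|)-a(x)\le f(x,z)\qquad\text{for a.e. }x\in\Omega\text{ and all }z\in\mathbb R^n .$$ Let $u_*\in W^{1,1}(\Omega)$, and assume that $a$ and $x\mapsto f(x,Du_*(x))$ belong to $L^\sigma(\Omega)$. Put $$\mathcal C=\{w\in u_*+W^{1,1}_0(\Omega):\ f(x,Dw(x))\in L^1(\Omega)\},$$ and let $u\in\mathcal C$ satisfy $\int_\Omega f(x,Du)\,dx\le\int_\Omega f(x,Dw)\,dx$ for all $w\in\mathcal C$. Then: 1. if $\sigma>\frac np$, then $u-u_*\in L^\infty(\Omega)$; 2. if $\sigma=\frac np$, then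 $e^{\tau|u-u_*|}\in L^1(\Omega)$ for some $\tau>0$ that depends only on $n,p,\mu,\nu$ and $\|f(x,Du_*)+a\|_{L^\sigma(\Omega)}$; 3. if $\sigma<\frac np$, then $g(|u-u_*|)\in L_w^{m}(\Omega)$ with $m=\frac{np\sigma}{n-p\sigma}>p^*=\frac{np}{n-p}$, where $L_w^m(\Omega)$ is the Marcinkiewicz space of all measurable $h$ on $\Omega$ for which there is a constant $\gamma$ with $|\{x\in\Omega:|h(x)|>\lambda\}|\le\gamma\lambda^{-m}$ for all $\lambda>0$. Moreover, $u-u_*\in L^\infty(\Omega)$ if and only if $g(|u-u_*|)\in L^\infty(\Omega)$. -/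

import Mathlib

open MeasureTheory Filter Topology Set
open scoped ENNReal ContDiff

noncomputable section

/-- `φ ∈ C_c^∞(Ω)`: smooth, with compact support contained in `Ω`. -/
def IsTestFunction {n : ℕ} (Ω : Set (EuclideanSpace ℝ (Fin n)))
    (φ : EuclideanSpace ℝ (Fin n) → ℝ) : Prop :=
  ContDiff ℝ ∞ φ ∧ HasCompactSupport φ ∧ tsupport φ ⊆ Ω

/-- `G` is a weak (distributional) gradient of `u` on `Ω`: both are locally integrable on `Ω`, and
`∫_Ω u ∂ᵢφ = - ∫_Ω Gᵢ φ` for all `φ ∈ C_c^∞(Ω)` and all coordinates `i`. -/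
def HasWeakGradient {n : ℕ} (Ω : Set (EuclideanSpace ℝ (Fin n)))
    (u : EuclideanSpace ℝ (Fin n) → ℝ)
    (G : EuclideanSpace ℝ (Fin n) → EuclideanSpace ℝ (Fin n)) : Prop :=
  LocallyIntegrableOn u Ω ∧ LocallyIntegrableOn G Ω ∧
    ∀ φ : EuclideanSpace ℝ (Fin n) → ℝ, IsTestFunction Ω φ → ∀ i : Fin n,
      ∫ x in Ω, u x * fderiv ℝ φ x (EuclideanSpace.single i 1) = -∫ x in Ω, G x i * φ x

/-- A weak gradient on an open set is unique up to equality almost everywhere. -/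
theorem HasWeakGradient.ae_eq {n : ℕ} {Ω : Set (EuclideanSpace ℝ (Fin n))} (hΩ : IsOpen Ω)
    {u : EuclideanSpace ℝ (Fin n) → ℝ}
    {G H : EuclideanSpace ℝ (Fin n) → EuclideanSpace ℝ (Fin n)}
    (hG : HasWeakGradient Ω u G) (hH : HasWeakGradient Ω u H) :
    G =ᵐ[volume.restrict Ω] H := by
  have coord : ∀ (K : EuclideanSpace ℝ (Fin n) → EuclideanSpace ℝ (Fin n)),
      LocallyIntegrableOn K Ω → ∀ i, LocallyIntegrableOn (fun x => K x i) Ω := by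
    intro K hK i x hx
    obtain ⟨s, hs, hi⟩ := hK x hx
    exact ⟨s, hs, (EuclideanSpace.proj (𝕜 := ℝ) i).integrable_comp hi⟩
  have key : ∀ i, ∀ᵐ x ∂(volume : Measure (EuclideanSpace ℝ (Fin n))),
      x ∈ Ω → G x i - H x i = 0 := by
    intro i
    have hGi := coord G hG.2.1 i
    have hHi := coord H hH.2.1 i
    refine hΩ.ae_eq_zero_of_integral_contDiff_smul_eq_zero (hGi.sub hHi) ?_
    intro φ hφ hc hs
    have e : ∀ (K : EuclideanSpace ℝ (Fin n) → ℝ),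
        ∫ x, φ x * K x = ∫ x in Ω, K x * φ x := by
      intro K
      rw [setIntegral_eq_integral_of_forall_compl_eq_zero]
      · simp only [mul_comm]
      · intro x hx
        rw [image_eq_zero_of_notMem_tsupport (fun h => hx (hs h)), mul_zero]
    have int : ∀ (K : EuclideanSpace ℝ (Fin n) → ℝ), LocallyIntegrableOn K Ω →
        IntegrableOn (fun x => K x * φ x) Ω := by
      intro K hK
      have h1 : IntegrableOn (fun x => K x * φ x) (tsupport φ) :=
        (hK.integrableOn_compact_subset hs hc).mul_continuousOn hφ.continuous.continuousOn hc
      have h2 : Integrable (fun x => K x * φ x) := by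
        rw [← integrableOn_iff_integrable_of_support_subset (s := tsupport φ)]
        · exact h1
        · intro x hx
          refine subset_tsupport _ ?_
          intro h
          exact hx (by simp [h])
      exact h2.integrableOn
    have h1 := hG.2.2 φ ⟨hφ, hc, hs⟩ i
    have h2 := hH.2.2 φ ⟨hφ, hc, hs⟩ i
    simp only [smul_eq_mul]
    rw [e]
    simp only [sub_mul]
    rw [integral_sub (int _ hGi) (int _ hHi)]
    linarith
  rw [EventuallyEq, ae_restrict_iff' hΩ.measurableSet]
  filter_upwards [ae_all_iff.2 key] with x hx hxΩ
  ext i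
  exact sub_eq_zero.1 (hx i hxΩ)

open Classical in
/-- The weak gradient `Du` of `u` on `Ω` (zero if there is none). -/
def weakGradient {n : ℕ} (Ω : Set (EuclideanSpace ℝ (Fin n)))
    (u : EuclideanSpace ℝ (Fin n) → ℝ) :
    EuclideanSpace ℝ (Fin n) → EuclideanSpace ℝ (Fin n) :=
  if h : ∃ G, HasWeakGradient Ω u G then h.choose else 0

theorem HasWeakGradient.weakGradient {n : ℕ} {Ω : Set (EuclideanSpace ℝ (Fin n))}
    {u : EuclideanSpace ℝ (Fin n) → ℝ}
    {G : EuclideanSpace ℝ (Fin n) → EuclideanSpace ℝ (Fin n)}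
    (hG : HasWeakGradient Ω u G) : HasWeakGradient Ω u (weakGradient Ω u) := by
  have h : ∃ G, HasWeakGradient Ω u G := ⟨G, hG⟩
  rw [_root_.weakGradient, dif_pos h]
  exact h.choose_spec

/-- `u ∈ W^{1,1}(Ω)`. -/
def MemW11 {n : ℕ} (Ω : Set (EuclideanSpace ℝ (Fin n)))
    (u : EuclideanSpace ℝ (Fin n) → ℝ) : Prop :=
  IntegrableOn u Ω ∧ HasWeakGradient Ω u (weakGradient Ω u) ∧ IntegrableOn (weakGradient Ω u) Ω

/-- `u ∈ W₀^{1,1}(Ω)`: the closure of `C_c^∞(Ω)` in `W^{1,1}(Ω)`. -/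
def MemW011 {n : ℕ} (Ω : Set (EuclideanSpace ℝ (Fin n)))
    (u : EuclideanSpace ℝ (Fin n) → ℝ) : Prop :=
  MemW11 Ω u ∧ ∃ φ : ℕ → EuclideanSpace ℝ (Fin n) → ℝ,
    (∀ k, IsTestFunction Ω (φ k)) ∧
    Tendsto (fun k => eLpNorm (fun x => u x - φ k x) 1 (volume.restrict Ω)) atTop (𝓝 0) ∧
    Tendsto (fun k => eLpNorm (fun x => weakGradient Ω u x - gradient (φ k) x) 1
      (volume.restrict Ω)) atTop (𝓝 0)

/-- The assumptions on `g : [0,∞) → [0,∞)`, with exponent `μ`. Only the values of `g` on `[0,∞)`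
matter; the derivatives at `0` are one-sided. -/
structure IsGrowthFunction (g : ℝ → ℝ) (μ : ℝ) : Prop where
  contDiffOn : ContDiffOn ℝ 1 g (Ici 0)
  convexOn : ConvexOn ℝ (Ici 0) g
  monotoneOn : MonotoneOn g (Ici 0)
  map_zero : g 0 = 0
  pos : ∀ t, 0 < t → 0 < g t
  one_le : 1 ≤ μ
  map_mul_le : ∀ lam, 1 < lam → ∀ t, 0 < t → g (lam * t) ≤ lam ^ μ * g t
  deriv_zero_pos : 0 < derivWithin g (Ici 0) 0

/-- `f : Ω × ℝⁿ → ℝ` is a Carathéodory function. -/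
def IsCaratheodory {n : ℕ} (Ω : Set (EuclideanSpace ℝ (Fin n)))
    (f : EuclideanSpace ℝ (Fin n) → EuclideanSpace ℝ (Fin n) → ℝ) : Prop :=
  (∀ z, AEMeasurable (fun x => f x z) (volume.restrict Ω)) ∧
    ∀ᵐ x ∂(volume.restrict Ω), Continuous (f x)

/-- The class of competing functions: `w ∈ u_* + W₀^{1,1}(Ω)` with `f(x, Dw(x)) ∈ L¹(Ω)`. -/
def competitors {n : ℕ} (Ω : Set (EuclideanSpace ℝ (Fin n)))
    (f : EuclideanSpace ℝ (Fin n) → EuclideanSpace ℝ (Fin n) → ℝ)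
    (ustar : EuclideanSpace ℝ (Fin n) → ℝ) : Set (EuclideanSpace ℝ (Fin n) → ℝ) :=
  {w | MemW011 Ω (fun x => w x - ustar x) ∧ IntegrableOn (fun x => f x (weakGradient Ω w x)) Ω}

/-- The variational integral `∫_Ω f(x, Du(x)) dx`. -/
def energy {n : ℕ} (Ω : Set (EuclideanSpace ℝ (Fin n)))
    (f : EuclideanSpace ℝ (Fin n) → EuclideanSpace ℝ (Fin n) → ℝ)
    (u : EuclideanSpace ℝ (Fin n) → ℝ) : ℝ :=
  ∫ x in Ω, f x (weakGradient Ω u x)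

/-- `u` minimizes the variational integral among all competitors. -/
def IsMinimizer {n : ℕ} (Ω : Set (EuclideanSpace ℝ (Fin n)))
    (f : EuclideanSpace ℝ (Fin n) → EuclideanSpace ℝ (Fin n) → ℝ)
    (ustar u : EuclideanSpace ℝ (Fin n) → ℝ) : Prop :=
  u ∈ competitors Ω f ustar ∧ ∀ w ∈ competitors Ω f ustar, energy Ω f u ≤ energy Ω f w

/-- The Marcinkiewicz (weak Lebesgue) space `L_w^m(Ω)`. -/
def MemMarcinkiewicz {n : ℕ} (Ω : Set (EuclideanSpace ℝ (Fin n))) (m : ℝ)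
    (h : EuclideanSpace ℝ (Fin n) → ℝ) : Prop :=
  AEMeasurable h (volume.restrict Ω) ∧
    ∃ γ : ℝ, ∀ lam : ℝ, 0 < lam →
      volume {x ∈ Ω | lam < |h x|} ≤ ENNReal.ofReal (γ / lam ^ m)

end

/-! Compare `u` with `u_* + T_k (u - u_*)`, where `T_k` truncates at the levels `±k`: minimality
bounds the energy of `u` on `{|u - u_*| > k}` by that of `u_*`, which Hölder's inequality controls
by a power of the measure `Φ(k)` of this set. By convexity, `t ≤ s + s g(t)^p / g(s)^p` for every
`s > 0`, so the growth condition turns this into a bound for the `L¹` norm of `D(u - u_*)` on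
`{|u - u_*| > k}`, namely a multiple of `s Φ(k)` as soon as `g(s) Φ(k)^{1/(σp)} ≥ N(k)`, where
`N(k)` comes from the `L^σ` norm of `f(x, Du_*) + a` on this set. The Sobolev inequality for
`T_h (u - u_*) - T_k (u - u_*)` then gives `(h - k) Φ(h)^{1 - 1/n} ≤ A s Φ(k)`.

If `s` is a multiple of `Φ(k)^{-1/(σp)}`, this iterates to `Φ = 0` eventually when `σ > n/p`, and
to geometric decay when `σ = n/p`; there every rate is reached, because `N(k) → 0`. If `σ < n/p`,
take `g(s)` to be a multiple of `Φ(k)^{-1/(σp)}`: doubling `k` then keeps `Φ(k) g(k)^m` bounded.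
-/

section L1Convergence

variable {α F : Type*} {mα : MeasurableSpace α} {μ : Measure α} [NormedAddCommGroup F]

theorem tendsto_eLpNorm_zero_of_le_mul {F' : Type*} [NormedAddCommGroup F'] {f : ℕ → α → F}
    {g : ℕ → α → F'} {p : ℝ≥0∞} {C : ℝ} (hfg : ∀ k x, ‖f k x‖ ≤ C * ‖g k x‖)
    (hg : Tendsto (fun k => eLpNorm (g k) p μ) atTop (𝓝 0)) :
    Tendsto (fun k => eLpNorm (f k) p μ) atTop (𝓝 0) :=
  tendsto_of_tendsto_of_tendsto_of_le_of_le tendsto_const_nhds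
    (by simpa using ENNReal.Tendsto.const_mul hg (Or.inr (ENNReal.ofReal_ne_top (r := C))))
    (fun _ => zero_le) fun k => eLpNorm_le_mul_eLpNorm_of_ae_le_mul (ae_of_all _ (hfg k)) p

theorem tendsto_eLpNorm_one_sub_of_dominated {f : ℕ → α → F} {g : α → F} {b : α → ℝ}
    (hf : ∀ k, AEStronglyMeasurable (f k) μ) (hb : Integrable b μ)
    (h_bound : ∀ k, ∀ᵐ x ∂μ, ‖f k x‖ ≤ b x)
    (h_lim : ∀ᵐ x ∂μ, Tendsto (fun k => f k x) atTop (𝓝 (g x))) :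
    Tendsto (fun k => eLpNorm (g - f k) 1 μ) atTop (𝓝 0) := by
  refine (tendsto_lintegral_norm_of_dominated_convergence hf hb.2 h_bound h_lim).congr fun k => ?_
  rw [eLpNorm_sub_comm, eLpNorm_one_eq_lintegral_enorm]
  simp [ofReal_norm]

theorem exists_subseq_ae_tendsto_of_eLpNorm_one {f : ℕ → α → F} {g : α → F}
    (hf : ∀ k, AEStronglyMeasurable (f k) μ) (hg : AEStronglyMeasurable g μ)
    (h : Tendsto (fun k => eLpNorm (g - f k) 1 μ) atTop (𝓝 0)) :
    ∃ ns : ℕ → ℕ, StrictMono ns ∧ ∀ᵐ x ∂μ, Tendsto (fun k => f (ns k) x) atTop (𝓝 (g x)) := by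
  refine (tendstoInMeasure_of_tendsto_eLpNorm_of_ne_top one_ne_zero ENNReal.one_ne_top hf hg
    ?_).exists_seq_tendsto_ae
  simpa only [eLpNorm_sub_comm] using h

theorem eLpNorm_one_sub_le_of_le_half {f g h : α → F} {δ : ℝ≥0∞} (hf : Integrable f μ)
    (hg : Integrable g μ) (hh : Integrable h μ) (hfg : eLpNorm (f - g) 1 μ ≤ δ / 2)
    (hgh : eLpNorm (g - h) 1 μ ≤ δ / 2) : eLpNorm (f - h) 1 μ ≤ δ :=
  calc eLpNorm (f - h) 1 μ = eLpNorm ((f - g) + (g - h)) 1 μ := by rw [sub_add_sub_cancel]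
    _ ≤ eLpNorm (f - g) 1 μ + eLpNorm (g - h) 1 μ :=
      eLpNorm_add_le (hf.sub hg).aestronglyMeasurable (hg.sub hh).aestronglyMeasurable le_rfl
    _ ≤ δ / 2 + δ / 2 := add_le_add hfg hgh
    _ = δ := ENNReal.add_halves δ

theorem eLpNorm_one_sub_sub_le_of_le_half {f f' g g' : α → F} {δ : ℝ≥0∞} (hf : Integrable f μ)
    (hf' : Integrable f' μ) (hg : Integrable g μ) (hg' : Integrable g' μ)
    (hfg : eLpNorm (f - g) 1 μ ≤ δ / 2) (hfg' : eLpNorm (f' - g') 1 μ ≤ δ / 2) :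
    eLpNorm ((f - f') - (g - g')) 1 μ ≤ δ := by
  refine eLpNorm_one_sub_le_of_le_half (g := f - g') (hf.sub hf') (hf.sub hg') (hg.sub hg') ?_ ?_
  · rwa [sub_sub_sub_cancel_left, eLpNorm_sub_comm]
  · rwa [sub_sub_sub_cancel_right]

theorem tendsto_integral_mul_of_tendsto_eLpNorm_one {f : ℕ → α → ℝ} {g b : α → ℝ} {C : ℝ}
    (hf : ∀ k, Integrable (f k) μ) (hg : Integrable g μ) (hb : AEStronglyMeasurable b μ)
    (hC : ∀ x, ‖b x‖ ≤ C) (h : Tendsto (fun k => eLpNorm (g - f k) 1 μ) atTop (𝓝 0)) :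
    Tendsto (fun k => ∫ x, f k x * b x ∂μ) atTop (𝓝 (∫ x, g x * b x ∂μ)) := by
  have hbC : ∀ᵐ x ∂μ, ‖b x‖ ≤ C := ae_of_all _ hC
  refine tendsto_integral_of_L1' _ (hg.mul_bdd hb hbC).aestronglyMeasurable
    (Eventually.of_forall fun k => (hf k).mul_bdd hb hbC) ?_
  simp only [eLpNorm_sub_comm g] at h
  refine tendsto_eLpNorm_zero_of_le_mul (C := C) (fun k x => ?_) h
  simp only [Pi.sub_apply]
  rw [← sub_mul, norm_mul, mul_comm]
  exact mul_le_mul_of_nonneg_right (hC x) (norm_nonneg _)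

theorem tendsto_eLpNorm_one_smul_sub_smul [NormedSpace ℝ F] {c : ℕ → α → ℝ} {c' : α → ℝ}
    {G : ℕ → α → F} {G' : α → F} {C : ℝ} (hG : ∀ k, Integrable (G k) μ) (hG' : Integrable G' μ)
    (hc : ∀ k, AEStronglyMeasurable (c k) μ) (hc' : AEStronglyMeasurable c' μ)
    (hC : ∀ k x, ‖c k x‖ ≤ C) (h_lim : ∀ᵐ x ∂μ, Tendsto (fun k => c k x) atTop (𝓝 (c' x)))
    (h : Tendsto (fun k => eLpNorm (G' - G k) 1 μ) atTop (𝓝 0)) :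
    Tendsto (fun k => eLpNorm (c' • G' - c k • G k) 1 μ) atTop (𝓝 0) := by
  have norm_smul_le k x y : ‖c k x • (y : F)‖ ≤ C * ‖y‖ := by
    rw [norm_smul]
    exact mul_le_mul_of_nonneg_right (hC k x) (norm_nonneg _)
  have fixed_factor : Tendsto (fun k => eLpNorm (c' • G' - c k • G') 1 μ) atTop (𝓝 0) :=
    tendsto_eLpNorm_one_sub_of_dominated (fun k => (hc k).smul hG'.aestronglyMeasurable)
      (hG'.norm.const_mul C) (fun k => ae_of_all _ fun x => norm_smul_le k x _)
      (h_lim.mono fun x hx => hx.smul_const _)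
  have fixed_coeff : Tendsto (fun k => eLpNorm (c k • (G' - G k)) 1 μ) atTop (𝓝 0) :=
    tendsto_eLpNorm_zero_of_le_mul (fun k x => norm_smul_le k x _) h
  have hsum := fixed_factor.add fixed_coeff
  rw [add_zero] at hsum
  refine tendsto_of_tendsto_of_tendsto_of_le_of_le tendsto_const_nhds hsum (fun _ => zero_le)
    fun k => ?_
  have split : c' • G' - c k • G k = (c' • G' - c k • G') + c k • (G' - G k) := by
    rw [smul_sub, sub_add_sub_cancel]
  rw [split]
  exact eLpNorm_add_le ((hc'.smul hG'.aestronglyMeasurable).sub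
      ((hc k).smul hG'.aestronglyMeasurable))
    ((hc k).smul (hG'.sub (hG k)).aestronglyMeasurable) le_rfl

theorem tendsto_eLpNorm_one_sub_apply {ι : Type*} [Fintype ι] {G : α → EuclideanSpace ℝ ι}
    {K : ℕ → α → EuclideanSpace ℝ ι}
    (h : Tendsto (fun k => eLpNorm (G - K k) 1 μ) atTop (𝓝 0)) (i : ι) :
    Tendsto (fun k => eLpNorm ((fun x => G x i) - fun x => K k x i) 1 μ) atTop (𝓝 0) :=
  tendsto_of_tendsto_of_tendsto_of_le_of_le tendsto_const_nhds h (fun _ => zero_le)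
    fun k => eLpNorm_mono fun x => PiLp.norm_apply_le (G x - K k x) i

end L1Convergence

section SobolevSpace

variable {n : ℕ} {Ω : Set (EuclideanSpace ℝ (Fin n))}

theorem gradient_apply_eq_fderiv_single (φ : EuclideanSpace ℝ (Fin n) → ℝ)
    (x : EuclideanSpace ℝ (Fin n)) (i : Fin n) :
    gradient φ x i = fderiv ℝ φ x (EuclideanSpace.single i 1) := by
  rw [← inner_gradient_left, EuclideanSpace.inner_single_right]
  simp

theorem norm_gradient_eq_norm_fderiv (φ : EuclideanSpace ℝ (Fin n) → ℝ)
    (x : EuclideanSpace ℝ (Fin n)) : ‖gradient φ x‖ = ‖fderiv ℝ φ x‖ := by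
  simp [gradient]

theorem integrable_euclideanSpace_apply {α ι : Type*} [Fintype ι] [MeasurableSpace α]
    {μ : Measure α} {G : α → EuclideanSpace ℝ ι} (hG : Integrable G μ) (i : ι) :
    Integrable (fun x => G x i) μ :=
  (EuclideanSpace.proj (𝕜 := ℝ) i).integrable_comp hG

namespace IsTestFunction

variable {φ ψ : EuclideanSpace ℝ (Fin n) → ℝ}

theorem continuous (hφ : IsTestFunction Ω φ) : Continuous φ := hφ.1.continuous

theorem differentiable (hφ : IsTestFunction Ω φ) : Differentiable ℝ φ :=
  hφ.1.differentiable (by simp)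

theorem continuous_fderiv (hφ : IsTestFunction Ω φ) : Continuous (fderiv ℝ φ) :=
  hφ.1.continuous_fderiv (by simp)

theorem continuous_fderiv_apply (hφ : IsTestFunction Ω φ) (e : EuclideanSpace ℝ (Fin n)) :
    Continuous fun x => fderiv ℝ φ x e :=
  hφ.continuous_fderiv.clm_apply continuous_const

theorem integrable (hφ : IsTestFunction Ω φ) : Integrable φ :=
  hφ.continuous.integrable_of_hasCompactSupport hφ.2.1

theorem integrable_gradient (hφ : IsTestFunction Ω φ) : Integrable (gradient φ) :=
  (InnerProductSpace.toDual ℝ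
    (EuclideanSpace ℝ (Fin n))).symm.toContinuousLinearEquiv.toContinuousLinearMap.integrable_comp
      (hφ.continuous_fderiv.integrable_of_hasCompactSupport (hφ.2.1.fderiv ℝ))

theorem eq_zero_of_notMem (hφ : IsTestFunction Ω φ) {x : EuclideanSpace ℝ (Fin n)}
    (hx : x ∉ Ω) : φ x = 0 :=
  image_eq_zero_of_notMem_tsupport fun h => hx (hφ.2.2 h)

theorem fderiv_eq_zero_of_notMem (hφ : IsTestFunction Ω φ) {x : EuclideanSpace ℝ (Fin n)}
    (hx : x ∉ Ω) : fderiv ℝ φ x = 0 :=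
  image_eq_zero_of_notMem_tsupport fun h => hx (hφ.2.2 (tsupport_fderiv_subset ℝ h))

theorem sub (hφ : IsTestFunction Ω φ) (hψ : IsTestFunction Ω ψ) :
    IsTestFunction Ω (fun x => φ x - ψ x) :=
  ⟨hφ.1.sub hψ.1, hφ.2.1.sub hψ.2.1,
    (tsupport_sub φ ψ).trans (union_subset hφ.2.2 hψ.2.2)⟩

theorem comp_left (hφ : IsTestFunction Ω φ) {η : ℝ → ℝ} (hη : ContDiff ℝ ∞ η) (h0 : η 0 = 0) :
    IsTestFunction Ω (fun x => η (φ x)) :=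
  ⟨hη.comp hφ.1, hφ.2.1.comp_left h0,
    (closure_mono (Function.support_comp_subset h0 φ)).trans hφ.2.2⟩

theorem gradient_sub (hφ : IsTestFunction Ω φ) (hψ : IsTestFunction Ω ψ)
    (x : EuclideanSpace ℝ (Fin n)) :
    gradient (fun x => φ x - ψ x) x = gradient φ x - gradient ψ x := by
  simp only [gradient]
  rw [fderiv_fun_sub (hφ.differentiable x) (hψ.differentiable x), map_sub]

theorem gradient_comp_left (hφ : IsTestFunction Ω φ) {η : ℝ → ℝ} (hη : Differentiable ℝ η)
    (x : EuclideanSpace ℝ (Fin n)) :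
    gradient (fun x => η (φ x)) x = deriv η (φ x) • gradient φ x := by
  have hfderiv : fderiv ℝ (fun x => η (φ x)) x = deriv η (φ x) • fderiv ℝ φ x :=
    ((hη (φ x)).hasDerivAt.comp_hasFDerivAt x (hφ.differentiable x).hasFDerivAt).fderiv
  simp only [gradient, hfderiv, map_smulₛₗ, conj_trivial]

theorem hasWeakGradient (hφ : IsTestFunction Ω φ) : HasWeakGradient Ω φ (gradient φ) := by
  refine ⟨hφ.integrable.integrableOn.locallyIntegrableOn,
    hφ.integrable_gradient.integrableOn.locallyIntegrableOn, fun ψ hψ i => ?_⟩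
  rw [setIntegral_eq_integral_of_forall_compl_eq_zero fun x hx => by
      simp [hψ.fderiv_eq_zero_of_notMem hx],
    setIntegral_eq_integral_of_forall_compl_eq_zero fun x hx => by
      simp [hψ.eq_zero_of_notMem hx]]
  simp only [gradient_apply_eq_fderiv_single]
  exact integral_mul_fderiv_eq_neg_fderiv_mul_of_integrable
    (((hφ.continuous_fderiv_apply _).mul hψ.continuous).integrable_of_hasCompactSupport
      hψ.2.1.mul_left)
    ((hφ.continuous.mul (hψ.continuous_fderiv_apply _)).integrable_of_hasCompactSupport
      hφ.2.1.mul_right)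
    ((hφ.continuous.mul hψ.continuous).integrable_of_hasCompactSupport hψ.2.1.mul_left)
    (fun x _ => hφ.differentiable x) (fun x _ => hψ.differentiable x)

end IsTestFunction

/-- `G` is the gradient of `v ∈ W₀^{1,1}(Ω)`: the pair `(v, G)` lies in the closure in `L¹(Ω)` of
the pairs `(φ, ∇φ)` with `φ` a test function. Unlike `MemW011` this names the gradient, so that
gradients can be computed by passing to the limit. -/
def HasW011Gradient (Ω : Set (EuclideanSpace ℝ (Fin n))) (v : EuclideanSpace ℝ (Fin n) → ℝ)
    (G : EuclideanSpace ℝ (Fin n) → EuclideanSpace ℝ (Fin n)) : Prop :=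
  IntegrableOn v Ω ∧ IntegrableOn G Ω ∧ ∀ δ : ℝ≥0∞, 0 < δ → ∃ φ, IsTestFunction Ω φ ∧
    eLpNorm (v - φ) 1 (volume.restrict Ω) ≤ δ ∧
    eLpNorm (G - gradient φ) 1 (volume.restrict Ω) ≤ δ

theorem IsTestFunction.hasW011Gradient {φ : EuclideanSpace ℝ (Fin n) → ℝ}
    (hφ : IsTestFunction Ω φ) : HasW011Gradient Ω φ (gradient φ) :=
  ⟨hφ.integrable.integrableOn, hφ.integrable_gradient.integrableOn,
    fun δ _ => ⟨φ, hφ, by simp, by simp⟩⟩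

namespace HasW011Gradient

variable {v w : EuclideanSpace ℝ (Fin n) → ℝ}
  {G H : EuclideanSpace ℝ (Fin n) → EuclideanSpace ℝ (Fin n)}

theorem exists_seq (h : HasW011Gradient Ω v G) :
    ∃ φ : ℕ → EuclideanSpace ℝ (Fin n) → ℝ, (∀ k, IsTestFunction Ω (φ k)) ∧
      Tendsto (fun k => eLpNorm (v - φ k) 1 (volume.restrict Ω)) atTop (𝓝 0) ∧
      Tendsto (fun k => eLpNorm (G - gradient (φ k)) 1 (volume.restrict Ω)) atTop (𝓝 0) := by
  obtain ⟨δ, -, hδ_mem, hδ⟩ := exists_seq_strictAnti_tendsto' (show (0 : ℝ≥0∞) < 1 by simp)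
  choose φ hφ hv hG using fun k => h.2.2 (δ k) (hδ_mem k).1
  exact ⟨φ, hφ,
    tendsto_of_tendsto_of_tendsto_of_le_of_le tendsto_const_nhds hδ (fun _ => zero_le) hv,
    tendsto_of_tendsto_of_tendsto_of_le_of_le tendsto_const_nhds hδ (fun _ => zero_le) hG⟩

theorem exists_seq_ae (h : HasW011Gradient Ω v G) :
    ∃ φ : ℕ → EuclideanSpace ℝ (Fin n) → ℝ, (∀ k, IsTestFunction Ω (φ k)) ∧
      Tendsto (fun k => eLpNorm (v - φ k) 1 (volume.restrict Ω)) atTop (𝓝 0) ∧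
      Tendsto (fun k => eLpNorm (G - gradient (φ k)) 1 (volume.restrict Ω)) atTop (𝓝 0) ∧
      ∀ᵐ x ∂(volume.restrict Ω), Tendsto (fun k => φ k x) atTop (𝓝 (v x)) := by
  obtain ⟨φ, hφ, hv, hG⟩ := h.exists_seq
  obtain ⟨ns, hns, hlim⟩ := exists_subseq_ae_tendsto_of_eLpNorm_one
    (fun k => (hφ k).integrable.aestronglyMeasurable.restrict) h.1.aestronglyMeasurable hv
  exact ⟨fun k => φ (ns k), fun k => hφ _, hv.comp hns.tendsto_atTop, hG.comp hns.tendsto_atTop,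
    hlim⟩

theorem of_tendsto {V : ℕ → EuclideanSpace ℝ (Fin n) → ℝ}
    {K : ℕ → EuclideanSpace ℝ (Fin n) → EuclideanSpace ℝ (Fin n)}
    (hv : IntegrableOn v Ω) (hG : IntegrableOn G Ω) (hVK : ∀ k, HasW011Gradient Ω (V k) (K k))
    (hV : Tendsto (fun k => eLpNorm (v - V k) 1 (volume.restrict Ω)) atTop (𝓝 0))
    (hK : Tendsto (fun k => eLpNorm (G - K k) 1 (volume.restrict Ω)) atTop (𝓝 0)) :
    HasW011Gradient Ω v G := by
  refine ⟨hv, hG, fun δ hδ => ?_⟩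
  have hδ2 : 0 < δ / 2 := ENNReal.half_pos hδ.ne'
  obtain ⟨k, hvV, hGK⟩ := ((ENNReal.tendsto_nhds_zero.1 hV _ hδ2).and
    (ENNReal.tendsto_nhds_zero.1 hK _ hδ2)).exists
  obtain ⟨φ, hφ, hVφ, hKφ⟩ := (hVK k).2.2 _ hδ2
  exact ⟨φ, hφ,
    eLpNorm_one_sub_le_of_le_half hv (hVK k).1 hφ.integrable.integrableOn hvV hVφ,
    eLpNorm_one_sub_le_of_le_half hG (hVK k).2.1 hφ.integrable_gradient.integrableOn hGK hKφ⟩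

theorem congr (h : HasW011Gradient Ω v G) (hGH : G =ᵐ[volume.restrict Ω] H) :
    HasW011Gradient Ω v H := by
  refine ⟨h.1, h.2.1.congr hGH, fun δ hδ => ?_⟩
  obtain ⟨φ, hφ, hvφ, hGφ⟩ := h.2.2 δ hδ
  exact ⟨φ, hφ, hvφ, (eLpNorm_congr_ae (hGH.symm.sub (ae_eq_refl _))).trans_le hGφ⟩

theorem sub (hv : HasW011Gradient Ω v G) (hw : HasW011Gradient Ω w H) :
    HasW011Gradient Ω (fun x => v x - w x) (fun x => G x - H x) := by
  refine ⟨hv.1.sub hw.1, hv.2.1.sub hw.2.1, fun δ hδ => ?_⟩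
  have hδ2 : 0 < δ / 2 := ENNReal.half_pos hδ.ne'
  obtain ⟨φ, hφ, hvφ, hGφ⟩ := hv.2.2 _ hδ2
  obtain ⟨ψ, hψ, hwψ, hHψ⟩ := hw.2.2 _ hδ2
  refine ⟨_, hφ.sub hψ, eLpNorm_one_sub_sub_le_of_le_half hv.1 hw.1 hφ.integrable.integrableOn
    hψ.integrable.integrableOn hvφ hwψ, ?_⟩
  rw [funext (hφ.gradient_sub hψ)]
  exact eLpNorm_one_sub_sub_le_of_le_half hv.2.1 hw.2.1 hφ.integrable_gradient.integrableOn
    hψ.integrable_gradient.integrableOn hGφ hHψ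

theorem hasWeakGradient (h : HasW011Gradient Ω v G) : HasWeakGradient Ω v G := by
  refine ⟨h.1.locallyIntegrableOn, h.2.1.locallyIntegrableOn, fun ψ hψ i => ?_⟩
  obtain ⟨φ, hφ, hvφ, hGφ⟩ := h.exists_seq
  obtain ⟨C, hC⟩ := hψ.2.1.exists_bound_of_continuous hψ.continuous
  obtain ⟨C', hC'⟩ := (hψ.2.1.fderiv_apply ℝ _).exists_bound_of_continuous
    (hψ.continuous_fderiv_apply (EuclideanSpace.single i 1))
  have left_lim := tendsto_integral_mul_of_tendsto_eLpNorm_one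
    (fun k => (hφ k).integrable.integrableOn) h.1
    (hψ.continuous_fderiv_apply _).aestronglyMeasurable hC' hvφ
  have right_lim := tendsto_integral_mul_of_tendsto_eLpNorm_one
    (fun k => integrable_euclideanSpace_apply (hφ k).integrable_gradient.integrableOn i)
    (integrable_euclideanSpace_apply h.2.1 i) hψ.continuous.aestronglyMeasurable hC
    (tendsto_eLpNorm_one_sub_apply hGφ i)
  exact tendsto_nhds_unique left_lim
    (right_lim.neg.congr fun k => ((hφ k).hasWeakGradient.2.2 ψ hψ i).symm)

end HasW011Gradient

theorem MemW011.hasW011Gradient {v : EuclideanSpace ℝ (Fin n) → ℝ} (h : MemW011 Ω v) :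
    HasW011Gradient Ω v (weakGradient Ω v) := by
  obtain ⟨⟨hv, -, hG⟩, φ, hφ, hvφ, hGφ⟩ := h
  exact .of_tendsto hv hG (fun k => (hφ k).hasW011Gradient) hvφ hGφ

theorem HasW011Gradient.memW011 {v : EuclideanSpace ℝ (Fin n) → ℝ}
    {G : EuclideanSpace ℝ (Fin n) → EuclideanSpace ℝ (Fin n)} (hΩ : IsOpen Ω)
    (h : HasW011Gradient Ω v G) : MemW011 Ω v := by
  have hweak := h.hasWeakGradient.weakGradient
  have h' := h.congr (h.hasWeakGradient.ae_eq hΩ hweak)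
  obtain ⟨φ, hφ, hvφ, hGφ⟩ := h'.exists_seq
  exact ⟨⟨h.1, hweak, h'.2.1⟩, φ, hφ, hvφ, hGφ⟩

end SobolevSpace

section Truncation

/-- The truncation of a real number `t` at the levels `±k`, for `k ≥ 0`. -/
def truncation (k t : ℝ) : ℝ := max (-k) (min k t)

theorem continuous_truncation (k : ℝ) : Continuous (truncation k) :=
  continuous_const.max (continuous_const.min continuous_id)

theorem truncation_of_abs_le {k t : ℝ} (h : |t| ≤ k) : truncation k t = t := by
  rw [truncation, min_eq_right (abs_le.1 h).2, max_eq_right (abs_le.1 h).1]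

theorem truncation_of_le {k t : ℝ} (hk : 0 ≤ k) (h : k ≤ t) : truncation k t = k := by
  rw [truncation, min_eq_left h, max_eq_right (by linarith)]

theorem truncation_of_le_neg {k t : ℝ} (h : t ≤ -k) : truncation k t = -k :=
  max_eq_left ((min_le_right _ _).trans h)

theorem abs_truncation_le {k : ℝ} (hk : 0 ≤ k) (t : ℝ) : |truncation k t| ≤ |t| := by
  rcases le_total |t| k with h | h
  · rw [truncation_of_abs_le h]
  · rcases le_abs.1 h with ht | ht
    · rwa [truncation_of_le hk ht, abs_of_nonneg hk]
    · rwa [truncation_of_le_neg (by linarith), abs_neg, abs_of_nonneg hk]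

theorem sub_le_abs_truncation_sub_truncation {k h t : ℝ} (hk : 0 ≤ k) (hkh : k ≤ h)
    (ht : h ≤ |t|) : h - k ≤ |truncation h t - truncation k t| := by
  rcases le_abs.1 ht with ht | ht
  · rw [truncation_of_le (hk.trans hkh) ht, truncation_of_le hk (hkh.trans ht)]
    exact le_abs_self _
  · rw [truncation_of_le_neg (by linarith), truncation_of_le_neg (by linarith)]
    exact (le_abs_self _).trans_eq (by rw [← abs_neg]; ring_nf)

theorem hasDerivAt_truncation {k t : ℝ} (hk : 0 ≤ k) (ht : |t| ≠ k) :
    HasDerivAt (truncation k) ((Icc (-k) k).indicator 1 t) t := by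
  rcases lt_or_gt_of_ne ht with h | h
  · rw [indicator_of_mem (mem_Icc.2 (abs_le.1 h.le)), Pi.one_apply]
    refine (hasDerivAt_id t).congr_of_eventuallyEq ?_
    filter_upwards [continuous_abs.continuousAt.eventually_lt_const h] with s hs
    exact truncation_of_abs_le hs.le
  · rw [indicator_of_notMem fun hmem => h.not_ge (abs_le.2 (mem_Icc.1 hmem))]
    rcases lt_abs.1 h with ht | ht
    · refine (hasDerivAt_const t k).congr_of_eventuallyEq ?_
      filter_upwards [lt_mem_nhds ht] with s hs
      exact truncation_of_le hk hs.le
    · refine (hasDerivAt_const t (-k)).congr_of_eventuallyEq ?_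
      filter_upwards [gt_mem_nhds (lt_neg.1 ht)] with s hs
      exact truncation_of_le_neg hs.le

theorem integral_indicator_Icc_neg {k : ℝ} (hk : 0 ≤ k) (t : ℝ) :
    ∫ s in (0 : ℝ)..t, (Icc (-k) k).indicator 1 s = truncation k t := by
  have hint : Integrable ((Icc (-k) k).indicator (1 : ℝ → ℝ)) :=
    (integrable_indicator_iff measurableSet_Icc).2 (integrableOn_const (by simp))
  rw [integral_eq_of_hasDerivAt_off_countable (truncation k) _
    (Set.Countable.insert k (countable_singleton (-k))) (continuous_truncation k).continuousOn
    (fun s hs => hasDerivAt_truncation hk ?_) hint.intervalIntegrable,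
    truncation_of_abs_le (t := 0) (by simpa using hk), sub_zero]
  exact fun h => hs.2 (by simpa using eq_or_eq_neg_of_abs_eq h)

/-- A smooth approximation of the indicator function of `[-k, k]`, improving as `j → ∞`. -/
noncomputable def smoothCutoff (k : ℝ) (j : ℕ) (t : ℝ) : ℝ :=
  Real.smoothTransition (1 + j * (k ^ 2 - t ^ 2))

theorem contDiff_smoothCutoff (k : ℝ) (j : ℕ) : ContDiff ℝ ∞ (smoothCutoff k j) :=
  Real.smoothTransition.contDiff.comp (by fun_prop)

theorem abs_smoothCutoff_le_one (k : ℝ) (j : ℕ) (t : ℝ) : |smoothCutoff k j t| ≤ 1 := by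
  rw [smoothCutoff, abs_of_nonneg (Real.smoothTransition.nonneg _)]
  exact Real.smoothTransition.le_one _

theorem tendsto_smoothCutoff {k : ℝ} (hk : 0 ≤ k) (t : ℝ) :
    Tendsto (fun j => smoothCutoff k j t) atTop (𝓝 ((Icc (-k) k).indicator 1 t)) := by
  by_cases ht : t ∈ Icc (-k) k
  · rw [indicator_of_mem ht]
    refine tendsto_const_nhds.congr fun j => (Real.smoothTransition.one_of_one_le ?_).symm
    exact le_add_of_nonneg_right (mul_nonneg j.cast_nonneg (sub_nonneg.2 (sq_le_sq' ht.1 ht.2)))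
  · rw [indicator_of_notMem ht]
    have hlt : k ^ 2 < t ^ 2 := by
      rw [sq_lt_sq, abs_of_nonneg hk]
      exact not_le.1 fun h => ht (abs_le.1 h)
    have hgrow : Tendsto (fun j : ℕ => (j : ℝ) * (t ^ 2 - k ^ 2)) atTop atTop :=
      tendsto_natCast_atTop_atTop.atTop_mul_const (sub_pos.2 hlt)
    refine tendsto_const_nhds.congr' ?_
    filter_upwards [hgrow.eventually_ge_atTop 1] with j hj
    exact (Real.smoothTransition.zero_of_nonpos (by linarith)).symm

/-- A smooth approximation of `truncation k`, improving as `j → ∞`. -/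
noncomputable def smoothTruncation (k : ℝ) (j : ℕ) (t : ℝ) : ℝ :=
  ∫ s in (0 : ℝ)..t, smoothCutoff k j s

theorem smoothTruncation_zero (k : ℝ) (j : ℕ) : smoothTruncation k j 0 = 0 :=
  intervalIntegral.integral_same

theorem hasDerivAt_smoothTruncation (k : ℝ) (j : ℕ) (t : ℝ) :
    HasDerivAt (smoothTruncation k j) (smoothCutoff k j t) t :=
  have hcont := (contDiff_smoothCutoff k j).continuous
  intervalIntegral.integral_hasDerivAt_right (hcont.intervalIntegrable _ _)
    (hcont.stronglyMeasurableAtFilter _ _) hcont.continuousAt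

theorem deriv_smoothTruncation (k : ℝ) (j : ℕ) :
    deriv (smoothTruncation k j) = smoothCutoff k j :=
  funext fun t => (hasDerivAt_smoothTruncation k j t).deriv

theorem contDiff_smoothTruncation (k : ℝ) (j : ℕ) : ContDiff ℝ ∞ (smoothTruncation k j) := by
  rw [contDiff_infty_iff_deriv, deriv_smoothTruncation]
  exact ⟨fun t => (hasDerivAt_smoothTruncation k j t).differentiableAt, contDiff_smoothCutoff k j⟩

theorem abs_smoothTruncation_le (k : ℝ) (j : ℕ) (t : ℝ) : |smoothTruncation k j t| ≤ |t| := by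
  simpa [smoothTruncation] using
    intervalIntegral.norm_integral_le_of_norm_le_const (a := 0) (b := t) (C := 1)
      (f := smoothCutoff k j) fun s _ => abs_smoothCutoff_le_one k j s

theorem tendsto_smoothTruncation {k : ℝ} (hk : 0 ≤ k) (t : ℝ) :
    Tendsto (fun j => smoothTruncation k j t) atTop (𝓝 (truncation k t)) := by
  rw [← integral_indicator_Icc_neg hk]
  exact intervalIntegral.tendsto_integral_filter_of_dominated_convergence (fun _ => 1)
    (Eventually.of_forall fun j => (contDiff_smoothCutoff k j).continuous.aestronglyMeasurable)
    (Eventually.of_forall fun j => ae_of_all _ fun s _ => abs_smoothCutoff_le_one k j s)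
    intervalIntegrable_const (ae_of_all _ fun s _ => tendsto_smoothCutoff hk s)

variable {n : ℕ} {Ω : Set (EuclideanSpace ℝ (Fin n))}
  {v : EuclideanSpace ℝ (Fin n) → ℝ} {G : EuclideanSpace ℝ (Fin n) → EuclideanSpace ℝ (Fin n)}

namespace HasW011Gradient

theorem comp_contDiff (h : HasW011Gradient Ω v G) {η : ℝ → ℝ} {C : ℝ} (hη : ContDiff ℝ ∞ η)
    (h0 : η 0 = 0) (hC : ∀ t, |deriv η t| ≤ C) :
    HasW011Gradient Ω (fun x => η (v x)) (fun x => deriv η (v x) • G x) := by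
  have hderiv : Continuous (deriv η) := hη.continuous_deriv (by simp)
  have hdiff : Differentiable ℝ η := hη.differentiable (by simp)
  have hlip s t : ‖η s - η t‖ ≤ C * ‖s - t‖ :=
    Convex.norm_image_sub_le_of_norm_deriv_le (fun x _ => hdiff x) (fun x _ => hC x)
      convex_univ (mem_univ t) (mem_univ s)
  have hv := h.1.aestronglyMeasurable
  obtain ⟨φ, hφ, hvφ, hGφ, hae⟩ := h.exists_seq_ae
  refine of_tendsto ?_ (h.2.1.bdd_smul C (hderiv.comp_aestronglyMeasurable hv)
    (ae_of_all _ fun x => hC _)) (fun k => ((hφ k).comp_left hη h0).hasW011Gradient)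
    (tendsto_eLpNorm_zero_of_le_mul (fun k x => hlip (v x) (φ k x)) hvφ) ?_
  · refine (h.1.norm.const_mul C).mono' (hη.continuous.comp_aestronglyMeasurable hv)
      (ae_of_all _ fun x => ?_)
    simpa [h0] using hlip (v x) 0
  · have hgradient k : gradient (fun x => η (φ k x)) =
        (fun x => deriv η (φ k x)) • gradient (φ k) :=
      funext ((hφ k).gradient_comp_left hdiff)
    simp only [hgradient]
    exact tendsto_eLpNorm_one_smul_sub_smul
      (fun k => (hφ k).integrable_gradient.integrableOn) h.2.1
      (fun k => (hderiv.comp (hφ k).continuous).aestronglyMeasurable)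
      (hderiv.comp_aestronglyMeasurable hv) (fun k x => hC _)
      (hae.mono fun x hx => (hderiv.tendsto _).comp hx) hGφ

theorem comp_truncation (h : HasW011Gradient Ω v G) {k : ℝ} (hk : 0 ≤ k) :
    HasW011Gradient Ω (fun x => truncation k (v x)) ({x | |v x| ≤ k}.indicator G) := by
  have hv := h.1.aestronglyMeasurable
  have happrox j := h.comp_contDiff (contDiff_smoothTruncation k j) (smoothTruncation_zero k j)
    (C := 1) (by simpa only [deriv_smoothTruncation] using abs_smoothCutoff_le_one k j)
  simp only [deriv_smoothTruncation] at happrox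
  have hset : NullMeasurableSet {x | |v x| ≤ k} (volume.restrict Ω) :=
    nullMeasurableSet_le hv.norm.aemeasurable aemeasurable_const
  refine of_tendsto (Integrable.mono h.1 ((continuous_truncation k).comp_aestronglyMeasurable hv)
      (ae_of_all _ fun x => abs_truncation_le hk _)) (h.2.1.indicator₀ hset) happrox
    (tendsto_eLpNorm_one_sub_of_dominated (fun j => (happrox j).1.aestronglyMeasurable)
      h.1.norm (fun j => ae_of_all _ fun x => abs_smoothTruncation_le k j _)
      (ae_of_all _ fun x => tendsto_smoothTruncation hk _))
    (tendsto_eLpNorm_one_sub_of_dominated (fun j => (happrox j).2.1.aestronglyMeasurable)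
      h.2.1.norm (fun j => ae_of_all _ fun x => ?_) (ae_of_all _ fun x => ?_))
  · rw [norm_smul]
    exact mul_le_of_le_one_left (norm_nonneg _) (abs_smoothCutoff_le_one k j _)
  · have hlim : {x | |v x| ≤ k}.indicator G x =
        (Icc (-k) k).indicator (1 : ℝ → ℝ) (v x) • G x := by
      simp only [indicator, mem_ofPred_eq, mem_Icc, ← abs_le, Pi.one_apply, ite_smul, one_smul,
        zero_smul]
    rw [hlim]
    exact (tendsto_smoothCutoff hk _).smul_const _

end HasW011Gradient

end Truncation

section SobolevInequality

variable {n : ℕ} {Ω : Set (EuclideanSpace ℝ (Fin n))} {q : NNReal}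

theorem IsTestFunction.eLpNorm_le {φ : EuclideanSpace ℝ (Fin n) → ℝ} (hφ : IsTestFunction Ω φ)
    (hq : NNReal.HolderConjugate n q) :
    eLpNorm φ q (volume.restrict Ω) ≤
      eLpNormLESNormFDerivOneConst (volume : Measure (EuclideanSpace ℝ (Fin n))) q *
        eLpNorm (gradient φ) 1 (volume.restrict Ω) := by
  have hsupport : Function.support (gradient φ) ⊆ Ω := fun x hx => by
    contrapose! hx
    simp [gradient, hφ.fderiv_eq_zero_of_notMem hx]
  rw [eLpNorm_restrict_eq_of_support_subset hsupport,
    eLpNorm_congr_norm_ae (ae_of_all _ (norm_gradient_eq_norm_fderiv φ))]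
  exact (eLpNorm_mono_measure _ Measure.restrict_le_self).trans
    (eLpNorm_le_eLpNorm_fderiv_one volume (hφ.1.of_le (by simp)) hφ.2.1
      (by rwa [finrank_euclideanSpace_fin]))

theorem HasW011Gradient.eLpNorm_le {v : EuclideanSpace ℝ (Fin n) → ℝ}
    {G : EuclideanSpace ℝ (Fin n) → EuclideanSpace ℝ (Fin n)} (h : HasW011Gradient Ω v G)
    (hq : NNReal.HolderConjugate n q) :
    eLpNorm v q (volume.restrict Ω) ≤
      eLpNormLESNormFDerivOneConst (volume : Measure (EuclideanSpace ℝ (Fin n))) q *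
        eLpNorm G 1 (volume.restrict Ω) := by
  set S := eLpNormLESNormFDerivOneConst (volume : Measure (EuclideanSpace ℝ (Fin n))) q
  obtain ⟨φ, hφ, -, hGφ, hae⟩ := h.exists_seq_ae
  have hbound k : eLpNorm (φ k) q (volume.restrict Ω) ≤
      S * (eLpNorm G 1 (volume.restrict Ω) +
        eLpNorm (G - gradient (φ k)) 1 (volume.restrict Ω)) :=
    calc eLpNorm (φ k) q (volume.restrict Ω)
        ≤ S * eLpNorm (gradient (φ k)) 1 (volume.restrict Ω) := (hφ k).eLpNorm_le hq
      _ = S * eLpNorm (G - (G - gradient (φ k))) 1 (volume.restrict Ω) := by rw [sub_sub_cancel]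
      _ ≤ _ := by
        gcongr
        exact eLpNorm_sub_le h.2.1.aestronglyMeasurable
          (h.2.1.sub (hφ k).integrable_gradient.integrableOn).aestronglyMeasurable le_rfl
  have hlim := ENNReal.Tendsto.const_mul (a := (S : ℝ≥0∞))
    (hGφ.const_add (eLpNorm G 1 (volume.restrict Ω))) (Or.inr ENNReal.coe_ne_top)
  rw [add_zero] at hlim
  calc eLpNorm v q (volume.restrict Ω)
      ≤ liminf (fun k => eLpNorm (φ k) q (volume.restrict Ω)) atTop :=
        Lp.eLpNorm_lim_le_liminf_eLpNorm
          (fun k => (hφ k).integrable.aestronglyMeasurable.restrict) v hae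
    _ ≤ _ := liminf_le_liminf (Eventually.of_forall hbound)
    _ = S * eLpNorm G 1 (volume.restrict Ω) := hlim.liminf_eq

end SobolevInequality

section LevelSets

variable {α : Type*} {mα : MeasurableSpace α} {μ : Measure α} {v : α → ℝ}

/-- The distribution function `k ↦ μ {|v| > k}` of a real-valued function, with real values (hence
meaningful only where the measure is finite). -/
noncomputable def distributionFunction (μ : Measure α) (v : α → ℝ) (k : ℝ) : ℝ :=
  μ.real {x | k < |v x|}

theorem distributionFunction_nonneg (k : ℝ) : 0 ≤ distributionFunction μ v k := measureReal_nonneg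

theorem antitone_setOf_lt_abs (v : α → ℝ) : Antitone fun k : ℝ => {x | k < |v x|} :=
  fun _ _ hkl _ hx => lt_of_le_of_lt hkl hx

theorem distributionFunction_antitone [IsFiniteMeasure μ] : Antitone (distributionFunction μ v) :=
  fun _ _ hkl => measureReal_mono (antitone_setOf_lt_abs v hkl)

theorem nullMeasurableSet_lt_abs (hv : AEStronglyMeasurable v μ) (k : ℝ) :
    NullMeasurableSet {x | k < |v x|} μ :=
  nullMeasurableSet_lt aemeasurable_const hv.norm.aemeasurable

theorem tendsto_measure_lt_abs_atTop [IsFiniteMeasure μ] (hv : AEStronglyMeasurable v μ) :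
    Tendsto (fun k : ℝ => μ {x | k < |v x|}) atTop (𝓝 0) := by
  have hempty : ⋂ k : ℝ, {x | k < |v x|} = ∅ :=
    eq_empty_of_forall_notMem fun x hx => lt_irrefl |v x| (mem_iInter.1 hx |v x|)
  rw [← measure_empty (μ := μ), ← hempty]
  exact tendsto_measure_iInter_atTop (nullMeasurableSet_lt_abs hv) (antitone_setOf_lt_abs v)
    ⟨0, measure_ne_top _ _⟩

theorem tendsto_distributionFunction_atTop [IsFiniteMeasure μ] (hv : AEStronglyMeasurable v μ) :
    Tendsto (distributionFunction μ v) atTop (𝓝 0) :=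
  (ENNReal.tendsto_toReal ENNReal.zero_ne_top).comp (tendsto_measure_lt_abs_atTop hv)

theorem memLp_top_of_distributionFunction_eq_zero [IsFiniteMeasure μ]
    (hv : AEStronglyMeasurable v μ) {d : ℝ} (hd : distributionFunction μ v d = 0) :
    MemLp v ⊤ μ := by
  refine memLp_top_of_bound hv d (ae_iff.2 ?_)
  simpa only [not_le, Real.norm_eq_abs] using (measureReal_eq_zero_iff (by finiteness)).1 hd

theorem tendsto_eLpNorm_restrict_lt_abs_atTop [IsFiniteMeasure μ] (hv : AEStronglyMeasurable v μ)
    {F : α → ℝ} {σ : ℝ≥0∞} (hσ0 : σ ≠ 0) (hσ : σ ≠ ⊤) (hF : MemLp F σ μ) :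
    Tendsto (fun k : ℝ => (eLpNorm F σ (μ.restrict {x | k < |v x|})).toReal) atTop (𝓝 0) := by
  have hlim := (tendsto_setLIntegral_zero
    (lintegral_rpow_enorm_lt_top_of_eLpNorm_lt_top hσ0 hσ hF.2).ne
    (tendsto_measure_lt_abs_atTop hv)).ennrpow_const (1 / σ.toReal)
  rw [ENNReal.zero_rpow_of_pos (one_div_pos.2 (ENNReal.toReal_pos hσ0 hσ))] at hlim
  refine ((ENNReal.tendsto_toReal ENNReal.zero_ne_top).comp hlim).congr fun k => ?_
  rw [eLpNorm_eq_lintegral_rpow_enorm_toReal hσ0 hσ]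
  rfl

theorem antitone_eLpNorm_restrict_lt_abs {F : α → ℝ} {σ : ℝ≥0∞} (hF : MemLp F σ μ) :
    Antitone fun k : ℝ => (eLpNorm F σ (μ.restrict {x | k < |v x|})).toReal :=
  fun _ _ hkl => ENNReal.toReal_mono (hF.mono_measure Measure.restrict_le_self).2.ne
    (eLpNorm_mono_measure _ (Measure.restrict_mono_set _ (antitone_setOf_lt_abs v hkl)))

theorem mul_measureReal_rpow_le_eLpNorm {w : α → ℝ} {q : NNReal} (hq : q ≠ 0) (hw : MemLp w q μ)
    {t : ℝ} (ht : 0 ≤ t) :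
    t * μ.real {x | t ≤ |w x|} ^ (q : ℝ)⁻¹ ≤ (eLpNorm w q μ).toReal := by
  have hset : {x | ENNReal.ofReal t ≤ ‖w x‖ₑ} = {x | t ≤ |w x|} := by
    ext x
    rw [mem_ofPred_eq, mem_ofPred_eq, ← ofReal_norm,
      ENNReal.ofReal_le_ofReal_iff (norm_nonneg _), Real.norm_eq_abs]
  have hq' : (q : ℝ) ≠ 0 := NNReal.coe_ne_zero.2 hq
  have hMarkov := ENNReal.rpow_le_rpow (mul_meas_ge_le_pow_eLpNorm' μ (ENNReal.coe_ne_zero.2 hq)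
    ENNReal.coe_ne_top hw.1 (ENNReal.ofReal t)) (inv_nonneg.2 q.coe_nonneg)
  rw [ENNReal.coe_toReal, ENNReal.mul_rpow_of_nonneg _ _ (inv_nonneg.2 q.coe_nonneg),
    ENNReal.rpow_rpow_inv hq', ENNReal.rpow_rpow_inv hq', hset] at hMarkov
  have := ENNReal.toReal_mono hw.2.ne hMarkov
  rwa [ENNReal.toReal_mul, ← ENNReal.toReal_rpow, ENNReal.toReal_ofReal ht] at this

theorem setIntegral_le_eLpNorm_mul_measureReal_rpow [IsFiniteMeasure μ] {F : α → ℝ} {σ : ℝ}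
    (hσ : 1 ≤ σ) (hF : MemLp F (ENNReal.ofReal σ) μ) (A : Set α) :
    ∫ x in A, F x ∂μ ≤
      (eLpNorm F (ENNReal.ofReal σ) (μ.restrict A)).toReal * μ.real A ^ (1 - 1 / σ) := by
  have hσ0 : 0 < σ := one_pos.trans_le hσ
  have hHolder := eLpNorm_le_eLpNorm_mul_rpow_measure_univ (p := 1) (q := ENNReal.ofReal σ)
    (by simpa using hσ) hF.1.restrict (μ := μ.restrict A)
  rw [ENNReal.toReal_ofReal hσ0.le, ENNReal.toReal_one, div_one,
    Measure.restrict_apply_univ] at hHolder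
  have hfinite := ENNReal.mul_ne_top (hF.mono_measure (Measure.restrict_le_self (s := A))).2.ne
    (ENNReal.rpow_ne_top_of_nonneg (sub_nonneg.2 ((div_le_one hσ0).2 hσ)) (measure_ne_top μ A))
  calc ∫ x in A, F x ∂μ ≤ ∫ x in A, ‖F x‖ ∂μ :=
        (le_abs_self _).trans (norm_integral_le_integral_norm F)
    _ = (eLpNorm F 1 (μ.restrict A)).toReal := by
        rw [eLpNorm_one_eq_lintegral_enorm, ← integral_norm_eq_lintegral_enorm hF.1.restrict]
    _ ≤ _ := ENNReal.toReal_mono hfinite hHolder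
    _ = _ := by rw [ENNReal.toReal_mul, ← ENNReal.toReal_rpow]; rfl

end LevelSets

namespace HasW011Gradient

variable {n : ℕ} {Ω : Set (EuclideanSpace ℝ (Fin n))} {q : NNReal}
  {v : EuclideanSpace ℝ (Fin n) → ℝ} {G : EuclideanSpace ℝ (Fin n) → EuclideanSpace ℝ (Fin n)}

theorem memLp (hv : HasW011Gradient Ω v G) (hq : NNReal.HolderConjugate n q) :
    MemLp v q (volume.restrict Ω) :=
  ⟨hv.1.aestronglyMeasurable, (hv.eLpNorm_le hq).trans_lt
    (ENNReal.mul_lt_top ENNReal.coe_lt_top (memLp_one_iff_integrable.2 hv.2.1).2)⟩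

theorem mul_measureReal_rpow_le (hv : HasW011Gradient Ω v G) (hq : NNReal.HolderConjugate n q)
    {t : ℝ} (ht : 0 ≤ t) :
    t * (volume.restrict Ω).real {x | t ≤ |v x|} ^ (q : ℝ)⁻¹ ≤
      eLpNormLESNormFDerivOneConst (volume : Measure (EuclideanSpace ℝ (Fin n))) q *
        ∫ x in Ω, ‖G x‖ := by
  have hG : eLpNorm G 1 (volume.restrict Ω) ≠ ⊤ := (memLp_one_iff_integrable.2 hv.2.1).2.ne
  refine (mul_measureReal_rpow_le_eLpNorm hq.symm.ne_zero (hv.memLp hq) ht).trans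
    ((ENNReal.toReal_mono (ENNReal.mul_ne_top ENNReal.coe_ne_top hG)
      (hv.eLpNorm_le hq)).trans_eq ?_)
  rw [ENNReal.toReal_mul, ENNReal.coe_toReal, eLpNorm_one_eq_lintegral_enorm,
    integral_norm_eq_lintegral_enorm hv.2.1.aestronglyMeasurable]

/-- `T_h v - T_k v` has size `h - k` where `|v| > h`, and its gradient lives where `|v| > k`. -/
theorem sub_mul_distributionFunction_rpow_le [IsFiniteMeasure (volume.restrict Ω)]
    (hv : HasW011Gradient Ω v G) (hq : NNReal.HolderConjugate n q) {k h : ℝ} (hk : 0 ≤ k)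
    (hkh : k ≤ h) :
    (h - k) * distributionFunction (volume.restrict Ω) v h ^ (q : ℝ)⁻¹ ≤
      eLpNormLESNormFDerivOneConst (volume : Measure (EuclideanSpace ℝ (Fin n))) q *
        ∫ x in {x | k < |v x|}, ‖G x‖ ∂(volume.restrict Ω) := by
  have hw := (hv.comp_truncation (hk.trans hkh)).sub (hv.comp_truncation hk)
  refine (mul_le_mul_of_nonneg_left ?_ (sub_nonneg.2 hkh)).trans
    ((hw.mul_measureReal_rpow_le hq (sub_nonneg.2 hkh)).trans
      (mul_le_mul_of_nonneg_left ?_ NNReal.zero_le_coe))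
  · exact Real.rpow_le_rpow measureReal_nonneg (measureReal_mono fun x hx =>
      sub_le_abs_truncation_sub_truncation hk hkh (le_of_lt hx)) (by positivity)
  · have hmeas := nullMeasurableSet_lt_abs hv.1.aestronglyMeasurable k
    rw [← integral_indicator₀ hmeas]
    refine integral_mono hw.2.1.norm (hv.2.1.norm.indicator₀ hmeas) fun x => ?_
    by_cases hx : |v x| ≤ k
    · simp only [indicator, mem_ofPred_eq, hx, hx.trans hkh, if_true, sub_self,
        norm_zero, hx.not_gt, if_false, le_refl]
    · simp only [indicator, mem_ofPred_eq, hx, not_le.1 hx, if_true, if_false,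
        sub_zero]
      split_ifs <;> simp

end HasW011Gradient

section GrowthFunction

variable {g : ℝ → ℝ} {μ : ℝ}

theorem mul_le_mul_of_convexOn_of_le (hg : ConvexOn ℝ (Ici 0) g) (h0 : g 0 = 0) {s t : ℝ}
    (hs : 0 ≤ s) (hst : s ≤ t) : t * g s ≤ s * g t := by
  rcases (hs.trans hst).eq_or_lt with ht | ht
  · rw [← ht, le_antisymm (hst.trans ht.ge) hs]
  · have hconv := hg.2 (mem_Ici.2 ht.le) self_mem_Ici (div_nonneg hs ht.le)
      (sub_nonneg.2 ((div_le_one ht).2 hst)) (add_sub_cancel _ _)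
    simp only [smul_eq_mul, mul_zero, add_zero, h0, div_mul_cancel₀ _ ht.ne'] at hconv
    rwa [div_mul_eq_mul_div, le_div_iff₀ ht, mul_comm] at hconv

namespace IsGrowthFunction

theorem nonneg (hg : IsGrowthFunction g μ) {t : ℝ} (ht : 0 ≤ t) : 0 ≤ g t :=
  hg.map_zero.ge.trans (hg.monotoneOn self_mem_Ici ht ht)

theorem continuous_comp_abs (hg : IsGrowthFunction g μ) : Continuous fun t => g |t| :=
  hg.contDiffOn.continuousOn.comp_continuous continuous_abs abs_nonneg

theorem mul_le_mul_of_le (hg : IsGrowthFunction g μ) {s t : ℝ} (hs : 0 ≤ s) (hst : s ≤ t) :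
    t * g s ≤ s * g t :=
  mul_le_mul_of_convexOn_of_le hg.convexOn hg.map_zero hs hst

theorem exists_mul_le (hg : IsGrowthFunction g μ) : ∃ c, 0 < c ∧ ∀ t, 0 ≤ t → c * t ≤ g t := by
  refine ⟨_, hg.deriv_zero_pos, fun t ht => ?_⟩
  rcases ht.eq_or_lt with rfl | ht
  · simp [hg.map_zero]
  · have hslope := hg.convexOn.derivWithin_le_slope self_mem_Ici ht.le ht
      (hg.contDiffOn.differentiableOn one_ne_zero 0 self_mem_Ici)
    rwa [slope_def_field, hg.map_zero, sub_zero, sub_zero, le_div_iff₀ ht] at hslope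

theorem strictMonoOn (hg : IsGrowthFunction g μ) : StrictMonoOn g (Ici 0) := by
  intro s hs t ht hst
  have hmul := hg.mul_le_mul_of_le hs hst.le
  have htpos := hg.pos t (lt_of_le_of_lt hs hst)
  by_contra! hle
  nlinarith [mul_pos (sub_pos.2 hst) htpos, mul_le_mul_of_nonneg_left hle ht]

theorem exists_eq (hg : IsGrowthFunction g μ) {y : ℝ} (hy : 0 < y) : ∃ s, 0 < s ∧ g s = y := by
  obtain ⟨c, hc, hcg⟩ := hg.exists_mul_le
  have hyc : 0 ≤ y / c := by positivity
  have hle : y ≤ g (y / c) := by simpa only [mul_div_cancel₀ _ hc.ne'] using hcg (y / c) hyc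
  obtain ⟨s, hs, rfl⟩ := intermediate_value_Icc hyc
    (hg.contDiffOn.continuousOn.mono fun x hx => hx.1) ⟨hg.map_zero.trans_le hy.le, hle⟩
  refine ⟨s, hs.1.lt_of_ne fun h => ?_, rfl⟩
  rw [← h, hg.map_zero] at hy
  exact hy.false

theorem rpow_two_mul_le (hg : IsGrowthFunction g μ) {m t : ℝ} (hm : 0 ≤ m) (ht : 0 < t) :
    g (2 * t) ^ m ≤ 2 ^ (μ * m) * g t ^ m := by
  rw [Real.rpow_mul two_pos.le, ← Real.mul_rpow (by positivity) (hg.pos t ht).le]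
  exact Real.rpow_le_rpow (hg.nonneg (by positivity)) (hg.map_mul_le 2 one_lt_two t ht) hm

theorem le_add_mul_rpow_div (hg : IsGrowthFunction g μ) {p s t : ℝ} (hp : 1 ≤ p) (hs : 0 < s)
    (ht : 0 ≤ t) : t ≤ s + s * (g t ^ p / g s ^ p) := by
  have hgs := hg.pos s hs
  have hgt := hg.nonneg ht
  rcases le_total t s with h | h
  · exact h.trans (le_add_of_nonneg_right (by positivity))
  · have hratio : 1 ≤ g t / g s := (one_le_div hgs).2 (hg.monotoneOn hs.le ht h)
    calc t ≤ s * (g t / g s) := by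
          rw [← mul_div_assoc, le_div_iff₀ hgs]
          exact hg.mul_le_mul_of_le hs.le h
      _ ≤ s * (g t / g s) ^ p := by gcongr; exact Real.self_le_rpow_of_one_le hratio hp
      _ = s * (g t ^ p / g s ^ p) := by rw [Real.div_rpow hgt hgs.le]
      _ ≤ s + s * (g t ^ p / g s ^ p) := le_add_of_nonneg_left hs.le

theorem memLp_top_comp_abs_iff (hg : IsGrowthFunction g μ) {α : Type*} {mα : MeasurableSpace α}
    {m : Measure α} {v : α → ℝ} (hv : AEStronglyMeasurable v m) :
    MemLp v ⊤ m ↔ MemLp (fun x => g |v x|) ⊤ m := by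
  constructor <;> intro h
  · refine memLp_top_of_bound (hg.continuous_comp_abs.comp_aestronglyMeasurable hv)
      (g (eLpNorm v ⊤ m).toReal) ?_
    filter_upwards [ae_le_eLpNormEssSup (f := v) (μ := m)] with x hx
    have hle : |v x| ≤ (eLpNorm v ⊤ m).toReal := by
      simpa using ENNReal.toReal_mono h.2.ne hx
    rw [Real.norm_of_nonneg (hg.nonneg (abs_nonneg _))]
    exact hg.monotoneOn (abs_nonneg (v x)) ((abs_nonneg (v x)).trans hle) hle
  · obtain ⟨c, hc, hcg⟩ := hg.exists_mul_le
    refine h.of_le_mul hv (c := c⁻¹) (ae_of_all _ fun x => ?_)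
    rw [Real.norm_of_nonneg (hg.nonneg (abs_nonneg _)), Real.norm_eq_abs, ← div_eq_inv_mul,
      le_div_iff₀ hc, mul_comm]
    exact hcg _ (abs_nonneg _)

theorem memMarcinkiewicz_comp_abs (hg : IsGrowthFunction g μ) {n : ℕ}
    {Ω : Set (EuclideanSpace ℝ (Fin n))} (hΩ : MeasurableSet Ω) (hfin : volume Ω ≠ ⊤)
    {v : EuclideanSpace ℝ (Fin n) → ℝ} (hv : AEStronglyMeasurable v (volume.restrict Ω))
    {m γ : ℝ} (h : ∀ k, 0 < k → distributionFunction (volume.restrict Ω) v k * g k ^ m ≤ γ) :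
    MemMarcinkiewicz Ω m fun x => g |v x| := by
  have := isFiniteMeasure_restrict.2 hfin
  refine ⟨(hg.continuous_comp_abs.comp_aestronglyMeasurable hv).aemeasurable, γ,
    fun lam hlam => ?_⟩
  obtain ⟨k, hk, rfl⟩ := hg.exists_eq hlam
  have hset : {x ∈ Ω | g k < |(g |v x|)|} = {x | k < |v x|} ∩ Ω := by
    ext x
    rw [mem_inter_iff, and_comm]
    refine and_congr_right fun _ => ?_
    rw [abs_of_nonneg (hg.nonneg (abs_nonneg _))]
    exact hg.strictMonoOn.lt_iff_lt hk.le (abs_nonneg (v x))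
  rw [hset, ← Measure.restrict_apply' hΩ, ← ofReal_measureReal]
  exact ENNReal.ofReal_le_ofReal ((le_div_iff₀ (Real.rpow_pos_of_pos hlam _)).2 (h k hk))

end IsGrowthFunction

end GrowthFunction

section Energy

variable {n : ℕ} {Ω : Set (EuclideanSpace ℝ (Fin n))}

theorem integrableOn_mul_of_tsupport_subset {K b : EuclideanSpace ℝ (Fin n) → ℝ}
    (hK : LocallyIntegrableOn K Ω) (hb : Continuous b) (hc : HasCompactSupport b)
    (hs : tsupport b ⊆ Ω) : IntegrableOn (fun x => K x * b x) Ω := by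
  refine Integrable.integrableOn ((integrableOn_iff_integrable_of_support_subset
    ((Function.support_mul_subset_right K b).trans (subset_tsupport b))).1 ?_)
  exact (hK.integrableOn_compact_subset hs hc).mul_continuousOn hb.continuousOn hc

theorem locallyIntegrableOn_euclideanSpace_apply
    {K : EuclideanSpace ℝ (Fin n) → EuclideanSpace ℝ (Fin n)} (hK : LocallyIntegrableOn K Ω)
    (i : Fin n) : LocallyIntegrableOn (fun x => K x i) Ω := fun x hx =>
  let ⟨s, hs, hKs⟩ := hK x hx
  ⟨s, hs, integrable_euclideanSpace_apply hKs i⟩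

theorem HasWeakGradient.add {u w : EuclideanSpace ℝ (Fin n) → ℝ}
    {G H : EuclideanSpace ℝ (Fin n) → EuclideanSpace ℝ (Fin n)}
    (hu : HasWeakGradient Ω u G) (hw : HasWeakGradient Ω w H) :
    HasWeakGradient Ω (fun x => u x + w x) (fun x => G x + H x) := by
  refine ⟨hu.1.add hw.1, hu.2.1.add hw.2.1, fun φ hφ i => ?_⟩
  have hint {K : EuclideanSpace ℝ (Fin n) → ℝ} (hK : LocallyIntegrableOn K Ω) :
      IntegrableOn (fun x => K x * φ x) Ω :=
    integrableOn_mul_of_tsupport_subset hK hφ.continuous hφ.2.1 hφ.2.2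
  have hint_fderiv {K : EuclideanSpace ℝ (Fin n) → ℝ} (hK : LocallyIntegrableOn K Ω) :
      IntegrableOn (fun x => K x * fderiv ℝ φ x (EuclideanSpace.single i 1)) Ω :=
    integrableOn_mul_of_tsupport_subset hK (hφ.continuous_fderiv_apply _)
      (hφ.2.1.fderiv_apply ℝ _) ((tsupport_fderiv_apply_subset ℝ _).trans hφ.2.2)
  simp only [PiLp.add_apply, add_mul]
  rw [integral_add (hint_fderiv hu.1) (hint_fderiv hw.1), hu.2.2 φ hφ i, hw.2.2 φ hφ i,
    integral_add (hint (locallyIntegrableOn_euclideanSpace_apply hu.2.1 i))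
      (hint (locallyIntegrableOn_euclideanSpace_apply hw.2.1 i)), neg_add]

variable {f : EuclideanSpace ℝ (Fin n) → EuclideanSpace ℝ (Fin n) → ℝ}
  {a ustar u v : EuclideanSpace ℝ (Fin n) → ℝ}
  {G : EuclideanSpace ℝ (Fin n) → EuclideanSpace ℝ (Fin n)}

theorem HasW011Gradient.weakGradient_add_ae_eq (hv : HasW011Gradient Ω v G) (hΩ : IsOpen Ω)
    (hstar : MemW11 Ω ustar) :
    weakGradient Ω (fun x => v x + ustar x) =ᵐ[volume.restrict Ω]
      fun x => G x + weakGradient Ω ustar x :=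
  have h := hv.hasWeakGradient.add hstar.2.1
  h.weakGradient.ae_eq hΩ h

theorem MemW011.weakGradient_ae_eq_add (hv : MemW011 Ω fun x => u x - ustar x) (hΩ : IsOpen Ω)
    (hstar : MemW11 Ω ustar) :
    weakGradient Ω u =ᵐ[volume.restrict Ω]
      fun x => weakGradient Ω (fun x => u x - ustar x) x + weakGradient Ω ustar x := by
  simpa only [sub_add_cancel] using hv.hasW011Gradient.weakGradient_add_ae_eq hΩ hstar

theorem MemW011.comp_weakGradient_truncation_ae_eq (hv : MemW011 Ω fun x => u x - ustar x)
    (hΩ : IsOpen Ω) (hstar : MemW11 Ω ustar) {k : ℝ} (hk : 0 ≤ k) :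
    (fun x => f x (weakGradient Ω (fun x => truncation k (u x - ustar x) + ustar x) x))
      =ᵐ[volume.restrict Ω]
    {x | k < |u x - ustar x|}.indicator (fun x => f x (weakGradient Ω ustar x)) +
      {x | k < |u x - ustar x|}ᶜ.indicator (fun x => f x (weakGradient Ω u x)) := by
  filter_upwards [hv.weakGradient_ae_eq_add hΩ hstar,
    (hv.hasW011Gradient.comp_truncation hk).weakGradient_add_ae_eq hΩ hstar] with x hux hwx
  by_cases hx : |u x - ustar x| ≤ k
  · simp only [hwx, Pi.add_apply, indicator, mem_ofPred_eq, mem_compl_iff, hx, hx.not_gt, if_true,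
      if_false, not_false_iff, zero_add, ← hux]
  · simp only [hwx, Pi.add_apply, indicator, mem_ofPred_eq, mem_compl_iff, hx, not_le.1 hx,
      if_true, if_false, not_true, zero_add, add_zero]

theorem IsMinimizer.setIntegral_le (hu : IsMinimizer Ω f ustar u) (hΩ : IsOpen Ω)
    (hstar : MemW11 Ω ustar) (hf : IntegrableOn (fun x => f x (weakGradient Ω ustar x)) Ω)
    {k : ℝ} (hk : 0 ≤ k) :
    ∫ x in {x | k < |u x - ustar x|}, f x (weakGradient Ω u x) ∂(volume.restrict Ω) ≤
      ∫ x in {x | k < |u x - ustar x|}, f x (weakGradient Ω ustar x) ∂(volume.restrict Ω) := by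
  obtain ⟨⟨hv, hfu⟩, hmin⟩ := hu
  have hA := nullMeasurableSet_lt_abs hv.hasW011Gradient.1.aestronglyMeasurable k
  have hfw := hv.comp_weakGradient_truncation_ae_eq (f := f) hΩ hstar hk
  have hint_above := Integrable.indicator₀ hf hA
  have hint_below := Integrable.indicator₀ hfu hA.compl
  have hcompetitor : (fun x => truncation k (u x - ustar x) + ustar x) ∈ competitors Ω f ustar := by
    refine ⟨?_, (hint_above.add hint_below).congr hfw.symm⟩
    simpa only [add_sub_cancel_right] using (hv.hasW011Gradient.comp_truncation hk).memW011 hΩ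
  have henergy := hmin _ hcompetitor
  rw [energy, energy, integral_congr_ae hfw, integral_add' hint_above hint_below,
    integral_indicator₀ hA, integral_indicator₀ hA.compl, ← integral_add_compl₀ hA hfu] at henergy
  exact le_of_add_le_add_right henergy

end Energy

section GradientBound

variable {g : ℝ → ℝ} {p μ ν s : ℝ} {α E : Type*} {mα : MeasurableSpace α} {m : Measure α}
  [IsFiniteMeasure m] [NormedAddCommGroup E]

theorem IsGrowthFunction.integral_norm_le (hg : IsGrowthFunction g μ) (hp : 1 ≤ p) (hν : 0 < ν)
    (hs : 0 < s) {Z : α → E} {F : α → ℝ} (hF : Integrable F m)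
    (h : ∀ᵐ x ∂m, ν * g ‖Z x‖ ^ p ≤ F x) :
    ∫ x, ‖Z x‖ ∂m ≤ s * (m.real univ + (∫ x, F x ∂m) / (ν * g s ^ p)) := by
  have hgs : 0 < g s ^ p := Real.rpow_pos_of_pos (hg.pos s hs) p
  have hbound : ∀ᵐ x ∂m, ‖Z x‖ ≤ s + s / (ν * g s ^ p) * F x := by
    filter_upwards [h] with x hx
    calc ‖Z x‖ ≤ s + s * (g ‖Z x‖ ^ p / g s ^ p) := hg.le_add_mul_rpow_div hp hs (norm_nonneg _)
      _ = s + s / (ν * g s ^ p) * (ν * g ‖Z x‖ ^ p) := by field_simp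
      _ ≤ s + s / (ν * g s ^ p) * F x := by gcongr
  calc ∫ x, ‖Z x‖ ∂m ≤ ∫ x, (s + s / (ν * g s ^ p) * F x) ∂m :=
        integral_mono_of_nonneg (ae_of_all _ fun _ => norm_nonneg _)
          ((integrable_const s).add (hF.const_mul _)) hbound
    _ = s * (m.real univ + (∫ x, F x ∂m) / (ν * g s ^ p)) := by
        rw [integral_add (integrable_const s) (hF.const_mul _), integral_const, integral_const_mul,
          smul_eq_mul]
        ring

theorem IsGrowthFunction.integral_norm_sub_le (hg : IsGrowthFunction g μ) (hp : 1 ≤ p)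
    (hν : 0 < ν) (hs : 0 < s) {Y Z : α → E} {F H : α → ℝ} (hY : Integrable Y m)
    (hZ : Integrable Z m) (hF : Integrable F m) (hH : Integrable H m)
    (hYF : ∀ᵐ x ∂m, ν * g ‖Y x‖ ^ p ≤ F x) (hZH : ∀ᵐ x ∂m, ν * g ‖Z x‖ ^ p ≤ H x)
    (hFH : ∫ x, F x ∂m ≤ ∫ x, H x ∂m) :
    ∫ x, ‖Y x - Z x‖ ∂m ≤ 2 * s * (m.real univ + (∫ x, H x ∂m) / (ν * g s ^ p)) := by
  have hgs : 0 < ν * g s ^ p := mul_pos hν (Real.rpow_pos_of_pos (hg.pos s hs) p)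
  calc ∫ x, ‖Y x - Z x‖ ∂m ≤ ∫ x, (‖Y x‖ + ‖Z x‖) ∂m :=
        integral_mono (hY.sub hZ).norm (hY.norm.add hZ.norm) fun x => norm_sub_le _ _
    _ = ∫ x, ‖Y x‖ ∂m + ∫ x, ‖Z x‖ ∂m := integral_add hY.norm hZ.norm
    _ ≤ s * (m.real univ + (∫ x, F x ∂m) / (ν * g s ^ p)) +
        s * (m.real univ + (∫ x, H x ∂m) / (ν * g s ^ p)) :=
        add_le_add (hg.integral_norm_le hp hν hs hF hYF) (hg.integral_norm_le hp hν hs hH hZH)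
    _ ≤ s * (m.real univ + (∫ x, H x ∂m) / (ν * g s ^ p)) +
        s * (m.real univ + (∫ x, H x ∂m) / (ν * g s ^ p)) := by gcongr
    _ = _ := by ring

variable {n : ℕ} {Ω : Set (EuclideanSpace ℝ (Fin n))}
  {f : EuclideanSpace ℝ (Fin n) → EuclideanSpace ℝ (Fin n) → ℝ}
  {a ustar u : EuclideanSpace ℝ (Fin n) → ℝ}

theorem IsMinimizer.setIntegral_norm_weakGradient_sub_le [IsFiniteMeasure (volume.restrict Ω)]
    (hu : IsMinimizer Ω f ustar u) (hΩ : IsOpen Ω) (hstar : MemW11 Ω ustar)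
    (hf : IntegrableOn (fun x => f x (weakGradient Ω ustar x)) Ω) (ha : IntegrableOn a Ω)
    (hg : IsGrowthFunction g μ) (hp : 1 ≤ p) (hν : 0 < ν)
    (hbd : ∀ᵐ x ∂(volume.restrict Ω), ∀ z, ν * g ‖z‖ ^ p - a x ≤ f x z)
    {k : ℝ} (hk : 0 ≤ k) (hs : 0 < s) :
    ∫ x in {x | k < |u x - ustar x|}, ‖weakGradient Ω (fun x => u x - ustar x) x‖
        ∂(volume.restrict Ω) ≤
      2 * s * (distributionFunction (volume.restrict Ω) (fun x => u x - ustar x) k +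
        (∫ x in {x | k < |u x - ustar x|}, (f x (weakGradient Ω ustar x) + a x)
          ∂(volume.restrict Ω)) / (ν * g s ^ p)) := by
  set A := {x | k < |u x - ustar x|}
  set m := (volume.restrict Ω).restrict A
  have hsub := hu.1.1.weakGradient_ae_eq_add hΩ hstar
  have hDstar : Integrable (weakGradient Ω ustar) (volume.restrict Ω) := hstar.2.2
  have hDu : Integrable (weakGradient Ω u) (volume.restrict Ω) :=
    (Integrable.add hu.1.1.1.2.2 hDstar).congr hsub.symm
  have hfu : Integrable (fun x => f x (weakGradient Ω u x)) m := Integrable.restrict hu.1.2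
  have hfstar : Integrable (fun x => f x (weakGradient Ω ustar x)) m := Integrable.restrict hf
  have ham : Integrable a m := Integrable.restrict ha
  have hgrowth : ∀ᵐ x ∂m, ∀ z, ν * g ‖z‖ ^ p ≤ f x z + a x := by
    filter_upwards [ae_restrict_of_ae hbd] with x hx z using sub_le_iff_le_add.1 (hx z)
  have henergy : ∫ x, (f x (weakGradient Ω u x) + a x) ∂m ≤
      ∫ x, (f x (weakGradient Ω ustar x) + a x) ∂m := by
    rw [integral_add hfu ham, integral_add hfstar ham]
    exact add_le_add_left (hu.setIntegral_le hΩ hstar hf hk) _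
  calc ∫ x, ‖weakGradient Ω (fun x => u x - ustar x) x‖ ∂m
      = ∫ x, ‖weakGradient Ω u x - weakGradient Ω ustar x‖ ∂m := by
        refine integral_congr_ae ?_
        filter_upwards [ae_restrict_of_ae hsub] with x hx
        rw [hx, add_sub_cancel_right]
    _ ≤ 2 * s * (m.real univ + (∫ x, (f x (weakGradient Ω ustar x) + a x) ∂m) /
          (ν * g s ^ p)) :=
        hg.integral_norm_sub_le hp hν hs hDu.restrict hDstar.restrict (hfu.add ham)
          (hfstar.add ham) (hgrowth.mono fun x hx => hx _) (hgrowth.mono fun x hx => hx _) henergy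
    _ = _ := by rw [measureReal_restrict_apply_univ]; rfl

end GradientBound

section LevelSetDecay

theorem exists_eq_zero_of_sub_mul_le_mul_rpow {Ψ : ℝ → ℝ} (hΨ0 : ∀ k, 0 ≤ Ψ k)
    (hΨ : Antitone Ψ) {γ C : ℝ} (hγ : 1 < γ) (hC : 0 < C)
    (h : ∀ ⦃k h⦄, 0 ≤ k → k < h → (h - k) * Ψ h ≤ C * Ψ k ^ γ) : ∃ d, Ψ d = 0 := by
  have hδ : 0 < γ - 1 := sub_pos.2 hγ
  obtain ⟨B, hB, hΨB⟩ : ∃ B, 0 < B ∧ Ψ 0 ≤ B := ⟨Ψ 0 + 1, by linarith [hΨ0 0], by linarith⟩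
  obtain ⟨r, hr0, hr1, hrγ⟩ : ∃ r : ℝ, 0 < r ∧ r < 1 ∧ r ^ (γ - 1) = 1 / 2 :=
    ⟨(1 / 2) ^ (γ - 1)⁻¹, by positivity,
      Real.rpow_lt_one (by norm_num) (by norm_num) (by positivity),
      Real.rpow_inv_rpow (by norm_num) hδ.ne'⟩
  obtain ⟨d, hd0, hdr⟩ : ∃ d, 0 < d ∧ d * r = 2 * C * B ^ (γ - 1) :=
    ⟨2 * C * B ^ (γ - 1) / r, by positivity, div_mul_cancel₀ _ hr0.ne'⟩
  have hgeom : ∀ j : ℕ, Ψ (d * (1 - (1 / 2) ^ j)) ≤ B * r ^ j := by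
    intro j
    induction j with
    | zero => simpa using hΨB
    | succ j ih =>
      have hgap : d * (1 - (1 / 2) ^ (j + 1)) - d * (1 - (1 / 2) ^ j) = d * (1 / 2) ^ (j + 1) := by
        ring
      have hgap_pos : 0 < d * (1 / 2) ^ (j + 1) := by positivity
      have hlevel : 0 ≤ d * (1 - (1 / 2) ^ j) :=
        mul_nonneg hd0.le (sub_nonneg.2 (pow_le_one₀ (by norm_num) (by norm_num)))
      have hpow : (B * r ^ j) ^ γ = B ^ (γ - 1) * (1 / 2) ^ j * (B * r ^ j) := by
        rw [← hrγ, Real.rpow_pow_comm hr0.le, ← Real.mul_rpow hB.le (by positivity),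
          ← Real.rpow_add_one (by positivity), sub_add_cancel]
      refine le_of_mul_le_mul_left ?_ hgap_pos
      calc d * (1 / 2) ^ (j + 1) * Ψ (d * (1 - (1 / 2) ^ (j + 1)))
          ≤ C * Ψ (d * (1 - (1 / 2) ^ j)) ^ γ := by
            rw [← hgap]; exact h hlevel (by linarith)
        _ ≤ C * (B * r ^ j) ^ γ := by gcongr; exact hΨ0 _
        _ = 2 * C * B ^ (γ - 1) * (1 / 2) ^ (j + 1) * (B * r ^ j) := by rw [hpow]; ring
        _ = d * (1 / 2) ^ (j + 1) * (B * r ^ (j + 1)) := by rw [← hdr]; ring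
  have hlim : Tendsto (fun j : ℕ => B * r ^ j) atTop (𝓝 0) := by
    simpa using (tendsto_pow_atTop_nhds_zero_of_lt_one hr0.le hr1).const_mul B
  refine ⟨d, le_antisymm (ge_of_tendsto' hlim fun j => (hΨ ?_).trans (hgeom j)) (hΨ0 d)⟩
  exact mul_le_of_le_one_right hd0.le (sub_le_self _ (by positivity))

theorem forall_pos_of_forall_two_mul {P : ℝ → Prop} {k₀ : ℝ} (hk₀ : 0 < k₀)
    (hbase : ∀ k, 0 < k → k ≤ 2 * k₀ → P k) (hstep : ∀ k, k₀ ≤ k → P k → P (2 * k)) {k : ℝ}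
    (hk : 0 < k) : P k := by
  have hdyadic : ∀ j : ℕ, ∀ k, 0 < k → k ≤ 2 ^ j * (2 * k₀) → P k := by
    intro j
    induction j with
    | zero => simpa using hbase
    | succ j ih =>
      intro k hk hkj
      rcases le_total k (2 * k₀) with hle | hle
      · exact hbase k hk hle
      · rw [← mul_div_cancel₀ k two_ne_zero]
        exact hstep _ (by linarith) (ih _ (by linarith) (by rw [pow_succ] at hkj; linarith))
  obtain ⟨j, hj⟩ := pow_unbounded_of_one_lt (k / (2 * k₀)) one_lt_two
  exact hdyadic j k hk ((div_lt_iff₀ (by positivity)).1 hj).le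

theorem eventually_mul_rpow_le_rpow {a b : ℝ} (hab : a < b) (C : ℝ) :
    ∀ᶠ x : ℝ in atTop, C * x ^ a ≤ x ^ b := by
  filter_upwards [(tendsto_rpow_atTop (sub_pos.2 hab)).eventually_ge_atTop C,
    eventually_gt_atTop 0] with x hx hx0
  calc C * x ^ a ≤ x ^ (b - a) * x ^ a := by gcongr
    _ = x ^ b := by rw [← Real.rpow_add hx0, sub_add_cancel]

/-- The decay inequality satisfied by the distribution function `Φ` of `u - u_*`: by the Sobolev
inequality, `(h - k) Φ(h)^θ ≤ A s Φ(k)` for every `s` which is so large that `g(s) Φ(k)^β`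
dominates the error term `N(k)`. -/
structure IsLevelSetDecay (g Φ N : ℝ → ℝ) (A θ β : ℝ) : Prop where
  nonneg : ∀ k, 0 ≤ Φ k
  antitone : Antitone Φ
  tendsto_zero : Tendsto Φ atTop (𝓝 0)
  error_antitone : Antitone N
  error_tendsto_zero : Tendsto N atTop (𝓝 0)
  const_pos : 0 < A
  exponent_pos : 0 < θ
  sub_mul_rpow_le : ∀ ⦃k h s⦄, 0 ≤ k → k < h → 0 < s → N k ≤ g s * Φ k ^ β →
    (h - k) * Φ h ^ θ ≤ A * s * Φ k

namespace IsLevelSetDecay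

variable {g Φ N : ℝ → ℝ} {A θ β : ℝ}

theorem rpow_eq_zero (hΦ : IsLevelSetDecay g Φ N A θ β) {k h : ℝ} (hk : Φ k = 0) (hkh : k ≤ h) :
    Φ h ^ θ = 0 := by
  rw [le_antisymm ((hΦ.antitone hkh).trans hk.le) (hΦ.nonneg h), Real.zero_rpow hΦ.exponent_pos.ne']

theorem sub_mul_rpow_le_rpow (hΦ : IsLevelSetDecay g Φ N A θ β) {c δ k h : ℝ}
    (hcg : ∀ t, 0 ≤ t → c * t ≤ g t) (hδ : 0 < δ) (hk : 0 ≤ k) (hkh : k < h) (hN : N k ≤ c * δ) :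
    (h - k) * Φ h ^ θ ≤ A * δ * Φ k ^ (1 - β) := by
  have hA := hΦ.const_pos
  have hnonneg := hΦ.nonneg k
  rcases hnonneg.eq_or_lt with hzero | hpos
  · rw [hΦ.rpow_eq_zero hzero.symm hkh.le, mul_zero]
    positivity
  · have hs : 0 < δ * Φ k ^ (-β) := by positivity
    have hadmissible : N k ≤ g (δ * Φ k ^ (-β)) * Φ k ^ β := by
      calc N k ≤ c * δ := hN
        _ = c * (δ * Φ k ^ (-β)) * Φ k ^ β := by rw [Real.rpow_neg hpos.le]; field_simp
        _ ≤ g (δ * Φ k ^ (-β)) * Φ k ^ β := by gcongr; exact hcg _ hs.le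
    calc (h - k) * Φ h ^ θ ≤ A * (δ * Φ k ^ (-β)) * Φ k :=
          hΦ.sub_mul_rpow_le hk hkh hs hadmissible
      _ = A * δ * Φ k ^ (1 - β) := by
          rw [sub_eq_add_neg, Real.rpow_add hpos, Real.rpow_one]; ring

theorem exists_eq_zero (hΦ : IsLevelSetDecay g Φ N A θ β) {c : ℝ} (hc : 0 < c)
    (hcg : ∀ t, 0 ≤ t → c * t ≤ g t) (hθβ : θ < 1 - β) : ∃ d, Φ d = 0 := by
  have hθ := hΦ.exponent_pos
  have hδ : 0 < max (N 0 / c) 1 := lt_max_of_lt_right one_pos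
  have hN : ∀ k, 0 ≤ k → N k ≤ c * max (N 0 / c) 1 := fun k hk =>
    calc N k ≤ N 0 := hΦ.error_antitone hk
      _ = c * (N 0 / c) := (mul_div_cancel₀ _ hc.ne').symm
      _ ≤ c * max (N 0 / c) 1 := by gcongr; exact le_max_left _ _
  obtain ⟨d, hd⟩ := exists_eq_zero_of_sub_mul_le_mul_rpow (Ψ := fun k => Φ k ^ θ)
    (γ := (1 - β) / θ) (fun k => Real.rpow_nonneg (hΦ.nonneg k) θ)
    (fun k h hkh => Real.rpow_le_rpow (hΦ.nonneg h) (hΦ.antitone hkh) hθ.le)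
    ((one_lt_div hθ).2 hθβ) (mul_pos hΦ.const_pos hδ) fun k h hk hkh => by
      rw [← Real.rpow_mul (hΦ.nonneg k), mul_div_cancel₀ _ hθ.ne']
      exact hΦ.sub_mul_rpow_le_rpow hcg hδ hk hkh (hN k hk)
  exact ⟨d, (Real.rpow_eq_zero (hΦ.nonneg d) hθ.ne').1 hd⟩

theorem eventually_add_one_le_mul (hΦ : IsLevelSetDecay g Φ N A θ β) {c q : ℝ} (hc : 0 < c)
    (hcg : ∀ t, 0 ≤ t → c * t ≤ g t) (hθβ : θ = 1 - β) (hq : 0 < q) :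
    ∀ᶠ k in atTop, Φ (k + 1) ≤ q * Φ k := by
  have hA := hΦ.const_pos
  have hδ : 0 < q ^ θ / A := by positivity
  filter_upwards [hΦ.error_tendsto_zero.eventually_le_const (mul_pos hc hδ),
    eventually_ge_atTop 0] with k hN hk
  rw [← Real.rpow_le_rpow_iff (hΦ.nonneg _) (mul_nonneg hq.le (hΦ.nonneg k)) hΦ.exponent_pos]
  calc Φ (k + 1) ^ θ = (k + 1 - k) * Φ (k + 1) ^ θ := by ring
    _ ≤ A * (q ^ θ / A) * Φ k ^ (1 - β) := hΦ.sub_mul_rpow_le_rpow hcg hδ hk (lt_add_one k) hN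
    _ = (q * Φ k) ^ θ := by
      rw [mul_div_cancel₀ _ hA.ne', ← hθβ, Real.mul_rpow hq.le (hΦ.nonneg k)]

theorem rpow_two_mul_le_or {μ : ℝ} (hΦ : IsLevelSetDecay g Φ N A θ β) (hg : IsGrowthFunction g μ)
    {N₀ k : ℝ} (hN₀ : 0 < N₀) (hk : 0 < k) (hN : N k ≤ N₀) :
    Φ (2 * k) ^ θ ≤ A * Φ k ∨ Φ (2 * k) ^ θ * g k ≤ A * N₀ * Φ k ^ (1 - β) := by
  have hA := hΦ.const_pos
  have hnonneg := hΦ.nonneg k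
  rcases hnonneg.eq_or_lt with hzero | hpos
  · left
    rw [hΦ.rpow_eq_zero hzero.symm (by linarith)]
    positivity
  · obtain ⟨s, hs, hgs⟩ := hg.exists_eq (show 0 < N₀ * Φ k ^ (-β) by positivity)
    have hadmissible : N k ≤ g s * Φ k ^ β := by
      rwa [hgs, mul_assoc, ← Real.rpow_add hpos, neg_add_cancel, Real.rpow_zero, mul_one]
    have hdecay : k * Φ (2 * k) ^ θ ≤ A * s * Φ k := by
      simpa only [two_mul, add_sub_cancel_right] using
        hΦ.sub_mul_rpow_le hk.le (h := 2 * k) (by linarith) hs hadmissible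
    rcases le_total s k with hsk | hks
    · refine Or.inl (le_of_mul_le_mul_left ?_ hk)
      calc k * Φ (2 * k) ^ θ ≤ A * s * Φ k := hdecay
        _ ≤ A * k * Φ k := by gcongr
        _ = k * (A * Φ k) := by ring
    · refine Or.inr (le_of_mul_le_mul_left ?_ hk)
      have hgk := hg.nonneg hk.le
      calc k * (Φ (2 * k) ^ θ * g k) = k * Φ (2 * k) ^ θ * g k := by ring
        _ ≤ A * s * Φ k * g k := by gcongr
        _ = A * Φ k * (s * g k) := by ring
        _ ≤ A * Φ k * (k * g s) := by gcongr A * Φ k * ?_; exact hg.mul_le_mul_of_le hk.le hks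
        _ = k * (A * N₀ * Φ k ^ (1 - β)) := by
          rw [hgs, sub_eq_add_neg, Real.rpow_add hpos, Real.rpow_one]; ring

theorem eventually_two_mul_le_mul_of_rpow_le (hΦ : IsLevelSetDecay g Φ N A θ β) (hθ : θ < 1)
    {η : ℝ} (hη : 0 < η) :
    ∀ᶠ k in atTop, Φ (2 * k) ^ θ ≤ A * Φ k → Φ (2 * k) ≤ η * Φ k := by
  have hθ' : 0 < 1 - θ := sub_pos.2 hθ
  have hlim : Tendsto (fun k => A * Φ k ^ (1 - θ)) atTop (𝓝 0) := by
    simpa only [Real.zero_rpow hθ'.ne', mul_zero] using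
      (hΦ.tendsto_zero.rpow_const (Or.inr hθ'.le)).const_mul A
  filter_upwards [hlim.eventually_le_const (show 0 < η ^ θ by positivity)] with k hk hle
  have hnonneg := hΦ.nonneg k
  rw [← Real.rpow_le_rpow_iff (hΦ.nonneg _) (by positivity) hΦ.exponent_pos]
  calc Φ (2 * k) ^ θ ≤ A * Φ k := hle
    _ = A * Φ k ^ (1 - θ) * Φ k ^ θ := by
      rw [mul_assoc, ← Real.rpow_add' hnonneg (by simp), sub_add_cancel, Real.rpow_one]
    _ ≤ η ^ θ * Φ k ^ θ := by gcongr
    _ = (η * Φ k) ^ θ := (Real.mul_rpow hη.le hnonneg).symm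

theorem mul_rpow_two_mul_rpow_le {μ m : ℝ} (hΦ : IsLevelSetDecay g Φ N A θ β)
    (hg : IsGrowthFunction g μ) (hm : 0 < m) (hmθ : m * (θ - (1 - β)) = 1) {C k : ℝ} (hk : 0 < k)
    (h : Φ (2 * k) ^ θ * g k ≤ C * Φ k ^ (1 - β)) :
    (Φ (2 * k) * g (2 * k) ^ m) ^ θ ≤ (2 ^ (μ * m)) ^ θ * C * (Φ k * g k ^ m) ^ (1 - β) := by
  have hθ := hΦ.exponent_pos
  have hgk := hg.pos k hk
  have hg2k := hg.nonneg (t := 2 * k) (by positivity)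
  have hnonneg := hΦ.nonneg k
  have hnonneg₂ := hΦ.nonneg (2 * k)
  have hexp : (g k ^ m) ^ θ = g k * (g k ^ m) ^ (1 - β) := by
    rw [← Real.rpow_mul hgk.le, ← Real.rpow_mul hgk.le, ← Real.rpow_one_add' hgk.le (by nlinarith)]
    congr 1
    linarith
  calc (Φ (2 * k) * g (2 * k) ^ m) ^ θ
      ≤ (Φ (2 * k) * (2 ^ (μ * m) * g k ^ m)) ^ θ := by
        gcongr; exact hg.rpow_two_mul_le hm.le hk
    _ = (2 ^ (μ * m)) ^ θ * (Φ (2 * k) ^ θ * g k) * (g k ^ m) ^ (1 - β) := by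
      rw [Real.mul_rpow hnonneg₂ (by positivity), Real.mul_rpow (by positivity) (by positivity),
        hexp]
      ring
    _ ≤ (2 ^ (μ * m)) ^ θ * (C * Φ k ^ (1 - β)) * (g k ^ m) ^ (1 - β) := by gcongr
    _ = (2 ^ (μ * m)) ^ θ * C * (Φ k * g k ^ m) ^ (1 - β) := by
      rw [Real.mul_rpow hnonneg (by positivity)]; ring

theorem exists_forall_mul_rpow_le {μ m : ℝ} (hΦ : IsLevelSetDecay g Φ N A θ β)
    (hg : IsGrowthFunction g μ) (hθ : θ < 1) (hβ : β ≤ 1) (hm : 0 < m)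
    (hmθ : m * (θ - (1 - β)) = 1) : ∃ γ, ∀ k, 0 < k → Φ k * g k ^ m ≤ γ := by
  obtain ⟨N₀, hN₀, hNN₀⟩ : ∃ N₀, 0 < N₀ ∧ ∀ k, 0 ≤ k → N k ≤ N₀ :=
    ⟨max (N 0) 1, by positivity, fun k hk => (hΦ.error_antitone hk).trans (le_max_left _ _)⟩
  have hη : (0 : ℝ) < (2 ^ (μ * m))⁻¹ := by positivity
  obtain ⟨k₀, hk₀, hk₀_pos⟩ := ((eventually_forall_ge_atTop.2
    (hΦ.eventually_two_mul_le_mul_of_rpow_le hθ hη)).and (eventually_gt_atTop 0)).exists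
  have hexp : 1 - β < θ := sub_pos.1 (pos_of_mul_pos_right (one_pos.trans_eq hmθ.symm) hm.le)
  obtain ⟨K, hK, hK_base, hK_pos⟩ := ((eventually_mul_rpow_le_rpow hexp
    ((2 ^ (μ * m)) ^ θ * (A * N₀))).and ((eventually_ge_atTop (Φ 0 * g (2 * k₀) ^ m)).and
    (eventually_gt_atTop 0))).exists
  refine ⟨K, fun k hk => forall_pos_of_forall_two_mul (P := fun k => Φ k * g k ^ m ≤ K)
    hk₀_pos (fun k hk hkk₀ => ?_) (fun k hk₀k hind => ?_) hk⟩
  · refine le_trans ?_ hK_base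
    have hgk := hg.pos k hk
    gcongr
    exacts [hΦ.nonneg 0, hΦ.antitone hk.le, hg.monotoneOn hk.le (hk.le.trans hkk₀) hkk₀]
  · have hk := hk₀_pos.trans_le hk₀k
    have hgk := hg.pos k hk
    have hg2k := hg.nonneg (t := 2 * k) (by positivity)
    have hnonneg := hΦ.nonneg k
    have hnonneg₂ := hΦ.nonneg (2 * k)
    rcases hΦ.rpow_two_mul_le_or hg hN₀ hk (hNN₀ k hk.le) with hfast | hslow
    · calc Φ (2 * k) * g (2 * k) ^ m
          ≤ (2 ^ (μ * m))⁻¹ * Φ k * (2 ^ (μ * m) * g k ^ m) := by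
            gcongr
            exacts [hk₀ k hk₀k hfast, hg.rpow_two_mul_le hm.le hk]
        _ = Φ k * g k ^ m := by field_simp
        _ ≤ K := hind
    · rw [← Real.rpow_le_rpow_iff (by positivity) hK_pos.le hΦ.exponent_pos]
      refine (hΦ.mul_rpow_two_mul_rpow_le hg hm hmθ hk hslow).trans (le_trans ?_ hK)
      have hA := hΦ.const_pos
      gcongr

end IsLevelSetDecay

end LevelSetDecay

section Minimizer

theorem mul_rpow_one_sub_le_of_rpow_inv_le {E G x p ν σ : ℝ} (hE : 0 ≤ E) (hG : 0 ≤ G)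
    (hx : 0 ≤ x) (hp : 0 < p) (hν : 0 < ν) (hσ : σ ≠ 0)
    (h : (E / ν) ^ p⁻¹ ≤ G * x ^ (1 / (σ * p))) : E * x ^ (1 - 1 / σ) ≤ ν * G ^ p * x := by
  have hE_le : E / ν ≤ G ^ p * x ^ (1 / σ) := by
    calc E / ν = ((E / ν) ^ p⁻¹) ^ p := (Real.rpow_inv_rpow (by positivity) hp.ne').symm
      _ ≤ (G * x ^ (1 / (σ * p))) ^ p := by gcongr
      _ = G ^ p * x ^ (1 / σ) := by
        rw [Real.mul_rpow hG (by positivity), ← Real.rpow_mul hx]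
        congr 2
        field_simp
  calc E * x ^ (1 - 1 / σ) = ν * (E / ν) * x ^ (1 - 1 / σ) := by rw [mul_div_cancel₀ _ hν.ne']
    _ ≤ ν * (G ^ p * x ^ (1 / σ)) * x ^ (1 - 1 / σ) := by gcongr
    _ = ν * G ^ p * (x ^ (1 / σ) * x ^ (1 - 1 / σ)) := by ring
    _ = ν * G ^ p * x := by
      rw [← Real.rpow_add' hx (by simp), add_sub_cancel, Real.rpow_one]

variable {n : ℕ} {Ω : Set (EuclideanSpace ℝ (Fin n))} {g : ℝ → ℝ} {p μ ν σ : ℝ}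
  {f : EuclideanSpace ℝ (Fin n) → EuclideanSpace ℝ (Fin n) → ℝ}
  {a ustar u : EuclideanSpace ℝ (Fin n) → ℝ}

theorem IsMinimizer.setIntegral_norm_le_four_mul [IsFiniteMeasure (volume.restrict Ω)]
    (hu : IsMinimizer Ω f ustar u) (hΩ : IsOpen Ω) (hstar : MemW11 Ω ustar)
    (hf : MemLp (fun x => f x (weakGradient Ω ustar x)) (ENNReal.ofReal σ) (volume.restrict Ω))
    (ha : MemLp a (ENNReal.ofReal σ) (volume.restrict Ω)) (hσ : 1 ≤ σ)
    (hg : IsGrowthFunction g μ) (hp : 1 ≤ p) (hν : 0 < ν)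
    (hbd : ∀ᵐ x ∂(volume.restrict Ω), ∀ z, ν * g ‖z‖ ^ p - a x ≤ f x z)
    {k s : ℝ} (hk : 0 ≤ k) (hs : 0 < s)
    (hsk : ((eLpNorm (fun x => f x (weakGradient Ω ustar x) + a x) (ENNReal.ofReal σ)
        ((volume.restrict Ω).restrict {x | k < |u x - ustar x|})).toReal / ν) ^ p⁻¹ ≤
      g s * distributionFunction (volume.restrict Ω) (fun x => u x - ustar x) k ^ (1 / (σ * p))) :
    ∫ x in {x | k < |u x - ustar x|}, ‖weakGradient Ω (fun x => u x - ustar x) x‖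
        ∂(volume.restrict Ω) ≤
      4 * s * distributionFunction (volume.restrict Ω) (fun x => u x - ustar x) k := by
  set Φ := distributionFunction (volume.restrict Ω) (fun x => u x - ustar x)
  have hσ1 : 1 ≤ ENNReal.ofReal σ := by simpa using hσ
  have hgs : 0 < ν * g s ^ p := mul_pos hν (Real.rpow_pos_of_pos (hg.pos s hs) p)
  have herror : ∫ x in {x | k < |u x - ustar x|}, (f x (weakGradient Ω ustar x) + a x)
      ∂(volume.restrict Ω) ≤ Φ k * (ν * g s ^ p) := by
    refine (setIntegral_le_eLpNorm_mul_measureReal_rpow hσ (hf.add ha) _).trans ?_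
    rw [mul_comm (Φ k)]
    exact mul_rpow_one_sub_le_of_rpow_inv_le ENNReal.toReal_nonneg (hg.nonneg hs.le)
      (distributionFunction_nonneg k) (by positivity) hν (by positivity) hsk
  calc _ ≤ 2 * s * (Φ k + (∫ x in {x | k < |u x - ustar x|},
            (f x (weakGradient Ω ustar x) + a x) ∂(volume.restrict Ω)) / (ν * g s ^ p)) :=
        hu.setIntegral_norm_weakGradient_sub_le hΩ hstar (hf.integrable hσ1) (ha.integrable hσ1)
          hg hp hν hbd hk hs
    _ ≤ 2 * s * (Φ k + Φ k) := by gcongr; exact (div_le_iff₀ hgs).2 herror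
    _ = 4 * s * Φ k := by ring

theorem IsMinimizer.exists_isLevelSetDecay [IsFiniteMeasure (volume.restrict Ω)]
    (hu : IsMinimizer Ω f ustar u) (hn : 2 ≤ n) (hΩ : IsOpen Ω) (hstar : MemW11 Ω ustar)
    (hf : MemLp (fun x => f x (weakGradient Ω ustar x)) (ENNReal.ofReal σ) (volume.restrict Ω))
    (ha : MemLp a (ENNReal.ofReal σ) (volume.restrict Ω)) (hσ : 1 ≤ σ)
    (hg : IsGrowthFunction g μ) (hp : 1 ≤ p) (hν : 0 < ν)
    (hbd : ∀ᵐ x ∂(volume.restrict Ω), ∀ z, ν * g ‖z‖ ^ p - a x ≤ f x z) :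
    ∃ N A, IsLevelSetDecay g
      (distributionFunction (volume.restrict Ω) fun x => u x - ustar x) N A
      (1 - 1 / n) (1 / (σ * p)) := by
  have hn1 : (1 : NNReal) < n := by exact_mod_cast hn
  have hp0 : 0 < p := one_pos.trans_le hp
  have hσ0 : ENNReal.ofReal σ ≠ 0 := by simpa using one_pos.trans_le hσ
  have hv := hu.1.1.hasW011Gradient
  have hvm := hv.1.aestronglyMeasurable
  have hq := NNReal.HolderConjugate.conjExponent hn1
  set q := NNReal.conjExponent n
  have hexp : (q : ℝ)⁻¹ = 1 - 1 / n := by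
    rw [one_div]; exact ((NNReal.holderConjugate_coe_iff.2 hq).one_sub_inv).symm
  have hF : MemLp (fun x => f x (weakGradient Ω ustar x) + a x) (ENNReal.ofReal σ)
    (volume.restrict Ω) := hf.add ha
  have hE := tendsto_eLpNorm_restrict_lt_abs_atTop hvm hσ0 ENNReal.ofReal_ne_top hF
  refine ⟨fun k => ((eLpNorm (fun x => f x (weakGradient Ω ustar x) + a x) (ENNReal.ofReal σ)
      ((volume.restrict Ω).restrict {x | k < |u x - ustar x|})).toReal / ν) ^ p⁻¹,
    4 * (eLpNormLESNormFDerivOneConst (volume : Measure (EuclideanSpace ℝ (Fin n))) q + 1),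
    distributionFunction_nonneg, distributionFunction_antitone,
    tendsto_distributionFunction_atTop hvm, fun k h hkh => ?_, ?_, by positivity, ?_,
    fun k h s hk hkh hs hsk => ?_⟩
  · exact Real.rpow_le_rpow (by positivity)
      (div_le_div_of_nonneg_right (antitone_eLpNorm_restrict_lt_abs hF hkh) hν.le) (by positivity)
  · simpa [hp0.ne'] using (hE.div_const ν).rpow_const (Or.inr (inv_nonneg.2 hp0.le))
  · rw [← hexp]; exact inv_pos.2 (by simpa using hq.symm.pos)
  · rw [← hexp]
    have hΦ := distributionFunction_nonneg (μ := volume.restrict Ω)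
      (v := fun x => u x - ustar x) k
    refine (hv.sub_mul_distributionFunction_rpow_le hq hk hkh.le).trans ?_
    calc _ ≤ eLpNormLESNormFDerivOneConst (volume : Measure (EuclideanSpace ℝ (Fin n))) q *
            (4 * s * distributionFunction (volume.restrict Ω) (fun x => u x - ustar x) k) := by
          gcongr
          exact hu.setIntegral_norm_le_four_mul hΩ hstar hf ha hσ hg hp hν hbd hk hs hsk
      _ ≤ (eLpNormLESNormFDerivOneConst (volume : Measure (EuclideanSpace ℝ (Fin n))) q + 1) *
            (4 * s * distributionFunction (volume.restrict Ω) (fun x => u x - ustar x) k) := by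
          gcongr; simp
      _ = _ := by ring

end Minimizer

section ExponentialIntegrability

theorem enorm_exp_mul_le_one_add_tsum {τ t : ℝ} (hτ : 0 ≤ τ) (ht : 0 ≤ t) :
    ‖Real.exp (τ * t)‖ₑ ≤ 1 + ∑' j : ℕ,
      (Iio t).indicator (fun _ => ENNReal.ofReal (Real.exp (τ * (j + 1)))) (j : ℝ) := by
  rw [Real.enorm_eq_ofReal (Real.exp_pos _).le]
  rcases ht.eq_or_lt with rfl | hpos
  · simp
  · obtain ⟨j, hj⟩ := Nat.exists_eq_add_one_of_ne_zero (Nat.ceil_pos.2 hpos).ne'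
    have hjt : (j : ℝ) < t := Nat.lt_ceil.1 (by lia)
    have htj : t ≤ j + 1 := by exact_mod_cast hj ▸ Nat.le_ceil t
    refine le_trans ?_ (le_add_left (ENNReal.le_tsum j))
    rw [indicator_of_mem (mem_Iio.2 hjt)]
    gcongr

variable {α : Type*} {mα : MeasurableSpace α} {μ : Measure α} [IsFiniteMeasure μ] {v : α → ℝ}

theorem integrable_exp_mul_abs_of_summable (hv : AEStronglyMeasurable v μ) {τ : ℝ} (hτ : 0 ≤ τ)
    (h : Summable fun j : ℕ => Real.exp (τ * (j + 1)) * distributionFunction μ v j) :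
    Integrable (fun x => Real.exp (τ * |v x|)) μ := by
  refine ⟨Real.continuous_exp.comp_aestronglyMeasurable (hv.norm.const_mul τ), ?_⟩
  have hterm : ∀ j : ℕ, ∫⁻ x, {x | (j : ℝ) < |v x|}.indicator
      (fun _ => ENNReal.ofReal (Real.exp (τ * (j + 1)))) x ∂μ =
        ENNReal.ofReal (Real.exp (τ * (j + 1)) * distributionFunction μ v j) := fun j => by
    rw [lintegral_indicator_const₀ (nullMeasurableSet_lt_abs hv _),
      ENNReal.ofReal_mul (Real.exp_pos _).le, distributionFunction, ofReal_measureReal]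
  refine (lintegral_mono fun x => enorm_exp_mul_le_one_add_tsum hτ (abs_nonneg (v x))).trans_lt ?_
  change ∫⁻ x, (1 + ∑' j : ℕ, {x | (j : ℝ) < |v x|}.indicator
    (fun _ => ENNReal.ofReal (Real.exp (τ * (j + 1)))) x) ∂μ < ⊤
  rw [lintegral_add_left measurable_const, lintegral_tsum fun j =>
    aemeasurable_const.indicator₀ (nullMeasurableSet_lt_abs hv _)]
  simp only [hterm]
  exact ENNReal.add_lt_top.2 ⟨by simp, h.tsum_ofReal_lt_top⟩

theorem integrable_exp_mul_abs_of_eventually_le (hv : AEStronglyMeasurable v μ) {τ q : ℝ}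
    (hτ : 0 ≤ τ) (hq : Real.exp τ * q < 1)
    (h : ∀ᶠ k in atTop, distributionFunction μ v (k + 1) ≤ q * distributionFunction μ v k) :
    Integrable (fun x => Real.exp (τ * |v x|)) μ := by
  refine integrable_exp_mul_abs_of_summable hv hτ (summable_of_ratio_norm_eventually_le hq ?_)
  filter_upwards [tendsto_natCast_atTop_atTop.eventually h] with j hj
  have hnonneg := distributionFunction_nonneg (μ := μ) (v := v)
  rw [Real.norm_of_nonneg (mul_nonneg (Real.exp_pos _).le (hnonneg _)),
    Real.norm_of_nonneg (mul_nonneg (Real.exp_pos _).le (hnonneg _)), Nat.cast_add, Nat.cast_one]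
  calc Real.exp (τ * (j + 1 + 1)) * distributionFunction μ v (j + 1)
      ≤ Real.exp (τ * (j + 1 + 1)) * (q * distributionFunction μ v j) := by gcongr
    _ = Real.exp τ * q * (Real.exp (τ * (j + 1)) * distributionFunction μ v j) := by
      rw [mul_add_one τ (j + 1 : ℝ), Real.exp_add]; ring

end ExponentialIntegrability

theorem sobolevExponent_lt_marcinkiewiczExponent {n p σ : ℝ} (hp : 0 < p) (hpn : p < n)
    (hσ : 1 < σ) (hσn : σ < n / p) : n * p / (n - p) < n * p * σ / (n - p * σ) := by
  have hpσ : 0 < n - p * σ := by linarith [(lt_div_iff₀' hp).1 hσn]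
  rw [div_lt_div_iff₀ (sub_pos.2 hpn) hpσ, mul_assoc (n * p)]
  exact mul_lt_mul_of_pos_left (by nlinarith) (mul_pos (hp.trans hpn) hp)

theorem mainTheorem3_general {n : ℕ} (hn : 2 ≤ n) {p μ ν σ : ℝ} (hp : 1 ≤ p) (hν : 0 < ν)
    (hσ : 1 ≤ σ) {Ω : Set (EuclideanSpace ℝ (Fin n))} (hΩ : IsOpen Ω) (hfin : volume Ω ≠ ⊤)
    {g : ℝ → ℝ} (hg : IsGrowthFunction g μ)
    {f : EuclideanSpace ℝ (Fin n) → EuclideanSpace ℝ (Fin n) → ℝ}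
    {a ustar u : EuclideanSpace ℝ (Fin n) → ℝ}
    (hbd : ∀ᵐ x ∂(volume.restrict Ω), ∀ z, ν * g ‖z‖ ^ p - a x ≤ f x z)
    (hstar : MemW11 Ω ustar) (ha : MemLp a (ENNReal.ofReal σ) (volume.restrict Ω))
    (hf : MemLp (fun x => f x (weakGradient Ω ustar x)) (ENNReal.ofReal σ) (volume.restrict Ω))
    (hu : IsMinimizer Ω f ustar u) :
    (n / p < σ → MemLp (fun x => u x - ustar x) ⊤ (volume.restrict Ω)) ∧
    (σ = n / p → ∀ τ, 0 < τ → IntegrableOn (fun x => Real.exp (τ * |u x - ustar x|)) Ω) ∧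
    (σ < n / p →
      MemMarcinkiewicz Ω (n * p * σ / (n - p * σ)) (fun x => g |u x - ustar x|)) ∧
    (MemLp (fun x => u x - ustar x) ⊤ (volume.restrict Ω) ↔
      MemLp (fun x => g |u x - ustar x|) ⊤ (volume.restrict Ω)) := by
  have := isFiniteMeasure_restrict.2 hfin
  have hn0 : (0 : ℝ) < n := by positivity
  have hp0 : 0 < p := one_pos.trans_le hp
  have : 0 < σ := one_pos.trans_le hσ
  have hv := hu.1.1.hasW011Gradient.1.aestronglyMeasurable
  obtain ⟨c, hc, hcg⟩ := hg.exists_mul_le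
  obtain ⟨N, A, hΦ⟩ := hu.exists_isLevelSetDecay hn hΩ hstar hf ha hσ hg hp hν hbd
  refine ⟨fun hlt => ?_, fun heq τ hτ => ?_, fun hlt => ?_, hg.memLp_top_comp_abs_iff hv⟩
  · have hexp : 1 - 1 / (n : ℝ) < 1 - 1 / (σ * p) :=
      sub_lt_sub_left (one_div_lt_one_div_of_lt hn0 ((div_lt_iff₀ hp0).1 hlt)) 1
    obtain ⟨d, hd⟩ := hΦ.exists_eq_zero hc hcg hexp
    exact memLp_top_of_distributionFunction_eq_zero hv hd
  · have hexp : 1 - 1 / (n : ℝ) = 1 - 1 / (σ * p) := by rw [heq, div_mul_cancel₀ _ hp0.ne']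
    refine integrable_exp_mul_abs_of_eventually_le hv hτ.le (q := Real.exp (-(τ + 1))) ?_
      (hΦ.eventually_add_one_le_mul hc hcg hexp (Real.exp_pos _))
    rw [← Real.exp_add, Real.exp_lt_one_iff]
    linarith
  · have hpσ : 0 < n - p * σ := by linarith [(lt_div_iff₀' hp0).1 hlt]
    have hexp : n * p * σ / (n - p * σ) * (1 - 1 / n - (1 - 1 / (σ * p))) = 1 := by
      field_simp
      ring
    obtain ⟨γ, hγ⟩ := hΦ.exists_forall_mul_rpow_le hg (sub_lt_self 1 (by positivity))
      ((div_le_one (by positivity)).2 (one_le_mul_of_one_le_of_one_le hσ hp)) (by positivity) hexp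
    exact hg.memMarcinkiewicz_comp_abs hΩ.measurableSet hfin hv hγ

theorem mainTheorem3 (n : ℕ) (hn : 2 ≤ n) (p μ ν M : ℝ) (hp : 1 < p) (hpn : p < n)
    (hμ : 1 ≤ μ) (hν : 0 < ν) :
    ∃ τ : ℝ, 0 < τ ∧
      ∀ (Ω : Set (EuclideanSpace ℝ (Fin n)))
        (g : ℝ → ℝ)
        (f : EuclideanSpace ℝ (Fin n) → EuclideanSpace ℝ (Fin n) → ℝ)
        (a ustar u : EuclideanSpace ℝ (Fin n) → ℝ)
        (σ : ℝ),
        IsOpen Ω → Bornology.IsBounded Ω →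
        IsGrowthFunction g μ →
        IsCaratheodory Ω f →
        (∀ x ∈ Ω, 0 ≤ a x) →
        (∀ᵐ x ∂(volume.restrict Ω), ∀ z, ν * g ‖z‖ ^ p - a x ≤ f x z) →
        MemW11 Ω ustar →
        1 < σ →
        MemLp a (ENNReal.ofReal σ) (volume.restrict Ω) →
        MemLp (fun x => f x (weakGradient Ω ustar x)) (ENNReal.ofReal σ) (volume.restrict Ω) →
        (eLpNorm (fun x => f x (weakGradient Ω ustar x) + a x) (ENNReal.ofReal σ)
          (volume.restrict Ω)).toReal = M →
        IsMinimizer Ω f ustar u →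
        (n / p < σ → MemLp (fun x => u x - ustar x) ⊤ (volume.restrict Ω)) ∧
        (σ = n / p → IntegrableOn (fun x => Real.exp (τ * |u x - ustar x|)) Ω) ∧
        (σ < n / p →
          MemMarcinkiewicz Ω (n * p * σ / (n - p * σ)) (fun x => g |u x - ustar x|) ∧
          n * p / (n - p) < n * p * σ / (n - p * σ)) ∧
        (MemLp (fun x => u x - ustar x) ⊤ (volume.restrict Ω) ↔
          MemLp (fun x => g |u x - ustar x|) ⊤ (volume.restrict Ω)) := by
  refine ⟨1, one_pos, fun Ω g f a ustar u σ hΩ hbdd hg _ _ hbd hstar hσ ha hf _ hu => ?_⟩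
  obtain ⟨hbounded, hexp, hweak, hiff⟩ := mainTheorem3_general hn hp.le hν hσ.le hΩ
    hbdd.measure_lt_top.ne hg hbd hstar ha hf hu
  exact ⟨hbounded, fun h => hexp h 1 one_pos, fun h => ⟨hweak h,
    sobolevExponent_lt_marcinkiewiczExponent (by linarith) hpn hσ h⟩, hiff⟩
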